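/- Setting. Let $f(y\mid\theta)=h(y)\exp(\theta y-\psi(\theta))$ be a one-parameter exponential family of densities with respect to a dominating measure $\mu$ on $\mathbb R$, with natural parameter space $\Theta=\{\theta:\int h(y)e^{\theta y}\mu(dy)<\infty\}$ and $\psi(\theta)=\log\int h(y)e^{\theta y}\mu(dy)$. Let $(x_i,y_i)$, $i=1,2,\dots$, be independent with $x_i\in\mathbb R^p$, $p\ge1$, $y_i\in\mathbb R$, such that the conditional law of $y_i$ given $x_i$ is $f(\cdot\mid\beta_0^Tx_i)$. Write $\mathcal F_n$ for the data $(x_i,y_i)_{i\le n}$ and let $\hat\beta_{\rm MLE}$ maximize $\sum_{i\le n}\{y_i\beta^Tx_i-\psi(\beta^Tx_i)\}$ over the parameter domain $\Lambda_B=\{\beta:\|\beta\|\le B,\ \beta^Tx\in\Theta\ \text{for all }x\in[-L,L]^p\}$. Assume: (H.1) $\|x_i\|\le L$ almost surely, for a constant $L>0$; (H.2) $\beta^Tx\in\mathrm{Int}(\Theta)$ for all $x\in[-L,L]^p$ and all $\beta\in\Lambda_B$; (H.3) $\Lambda_B$ is compact and $\beta_0\in\Lambda_B$; (H.4) $\mathcal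 J_X=n^{-1}\sum_{i\le n}\ddot\psi(\hat\beta_{\rm MLE}^Tx_i)x_ix_i^T$ converges in probability to a positive-definite matrix as $n\to\infty$. Two-step algorithm. Fix $\delta>0$. The pilot distribution $\pi_0=(\pi_{0i})_{i\le n}$ is a function of $\mathcal F_n$ with $\max_{i\le n}(n\pi_{0i})^{-1}=O_P(1)$ (for example $\pi_{0i}=1/n$). Draw $r_0$ indices $s_1,\dots,s_{r_0}$ independently from $\pi_0$, and let $\tilde\beta_0$ maximize $r_0^{-1}\sum_{k}\pi_{0s_k}^{-1}\{y_{s_k}\beta^Tx_{s_k}-\psi(\beta^Tx_{s_k})\}$ over $\Lambda_B$. Put $\tilde{\mathcal J}_X=(nr_0)^{-1}\sum_k\pi_{0s_k}^{-1}\ddot\psi(\tilde\beta_0^Tx_{s_k})x_{s_k}x_{s_k}^T$ and let $\tilde\pi_i$ be proportional to $\max(|y_i-\dot\psi(\tilde\beta_0^Tx_i)|,\delta)\,\|\tilde{\mathcal J}_X^{-1}x_i\|$ (criterion mV) or to $\max(|y_i-\dot\psi(\tilde\beta_0^Tx_i)|,\delta)\,\|x_i\|$ (criterion mVc). Given $\mathcal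 F_n$ and the pilot draws, draw $r$ further indices $t_1,\dots,t_r$ independently from $\tilde\pi$, and let $\breve\beta$ maximize over $\Lambda_B$ the function $$\frac1{r+r_0}\Big[\sum_{k=1}^{r_0}\frac{y_{s_k}\beta^Tx_{s_k}-\psi(\beta^Tx_{s_k})}{\pi_{0s_k}}+\sum_{k=1}^{r}\frac{y_{t_k}\beta^Tx_{t_k}-\psi(\beta^Tx_{t_k})}{\tilde\pi_{t_k}}\Big].$$ If $\tilde\pi$ is undefined (for example because $\tilde{\mathcal J}_X$ is singular), the algorithm fails, and this is counted in the conditional probability below as an error of any size. Theorem. Let $r_0=r_0(n,r)$ satisfy $r_0\to\infty$ and $r_0/r\to0$ as $n,r\to\infty$. Then, for either criterion, for every $\epsilon>0$ there is a finite $\Delta_\epsilon$ such that $$P\Big(P\big(\|\breve\beta-\hat\beta_{\rm MLE}\|\ge r^{-1/2}\Delta_\epsilon\,\big|\,\mathcal F_n\big)<\epsilon\ \text{ for all } r>R\Big)\longrightarrow1\qquad\text{as } n\to\infty,\ R\to\infty.$$ If, moreover, $\max_{i\le n}(n\pi_{0i})^{-1}$ is bounded by a constant with probability tending to one (for example $\pi_{0i}=1/n$),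 then for every $\epsilon>0$ there are finite $\Delta_\epsilon$ and $r_\epsilon$ such that $$P\Big(P\big(\|\breve\beta-\hat\beta_{\rm MLE}\|\ge r^{-1/2}\Delta_\epsilon\,\big|\,\mathcal F_n\big)<\epsilon\ \text{ for all } r>r_\epsilon\Big)\longrightarrow1\qquad\text{as } n\to\infty.$$ -/

import Mathlib

open MeasureTheory ProbabilityTheory Filter Topology
open scoped ENNReal

noncomputable section

namespace GLMSubsampling

/-- A one-parameter exponential family `f(y | θ) = h(y) exp(θ y - ψ(θ))` of densities with respect
to a dominating measure `μ` on `ℝ` (Lebesgue or counting measure, for instance). -/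
structure ExpFamily where
  μ : Measure ℝ
  h : ℝ → ℝ
  measurable_h : Measurable h
  h_nonneg : ∀ y, 0 ≤ h y

namespace ExpFamily

/-- The measure `h(y) μ(dy)`. -/
def base (F : ExpFamily) : Measure ℝ := F.μ.withDensity fun y => ENNReal.ofReal (F.h y)

/-- The natural parameter space: all `θ` with `∫ h(y) exp(θ y) μ(dy) < ∞`. -/
def naturalSpace (F : ExpFamily) : Set ℝ := integrableExpSet id F.base

/-- The normalizing function `ψ(θ) = log ∫ h(y) exp(θ y) μ(dy)`. -/
def ψ (F : ExpFamily) : ℝ → ℝ := cgf id F.base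

/-- The law with density `h(y) exp(θ y - ψ(θ))` with respect to `μ`. -/
def law (F : ExpFamily) (θ : ℝ) : Measure ℝ :=
  F.μ.withDensity fun y => ENNReal.ofReal (F.h y * Real.exp (θ * y - F.ψ θ))

end ExpFamily

/-- Full data `((x₁, y₁), …, (xₙ, yₙ))`, with `xᵢ ∈ ℝᵖ` and `yᵢ ∈ ℝ`. -/
abbrev Dataset (p n : ℕ) := Fin n → EuclideanSpace ℝ (Fin p) × ℝ

/-- The parameter domain `Λ_B`: all `β` with `‖β‖ ≤ B` and `βᵀx ∈ Θ` for every `x ∈ [-L, L]ᵖ`. -/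
def paramDomain (F : ExpFamily) (p : ℕ) (L B : ℝ) : Set (EuclideanSpace ℝ (Fin p)) :=
  {β | (∀ x : EuclideanSpace ℝ (Fin p), (∀ j, |x j| ≤ L) → inner ℝ β x ∈ F.naturalSpace) ∧
    ‖β‖ ≤ B}

/-- `b` is a maximizer of `f` over `S`. -/
def IsMaximizer {E : Type*} (S : Set E) (f : E → ℝ) (b : E) : Prop := b ∈ S ∧ IsMaxOn f S b

section Likelihood

variable {p n : ℕ} (F : ExpFamily)

/-- Contribution `y βᵀx - ψ(βᵀx)` of one observation `z = (x, y)` to the log-likelihood. -/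
def logTerm (z : EuclideanSpace ℝ (Fin p) × ℝ) (β : EuclideanSpace ℝ (Fin p)) : ℝ :=
  z.2 * inner ℝ β z.1 - F.ψ (inner ℝ β z.1)

/-- The full data log-likelihood. -/
def logLik (d : Dataset p n) (β : EuclideanSpace ℝ (Fin p)) : ℝ := ∑ i, logTerm F (d i) β

/-- The observed information matrix `n⁻¹ ∑ᵢ ψ''(βᵀxᵢ) xᵢ xᵢᵀ`. -/
def infoMatrix (d : Dataset p n) (β : EuclideanSpace ℝ (Fin p)) : Matrix (Fin p) (Fin p) ℝ :=
  (n : ℝ)⁻¹ • ∑ i, deriv (deriv F.ψ) (inner ℝ β (d i).1) •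
    Matrix.vecMulVec (d i).1.ofLp (d i).1.ofLp

/-- The pilot weighted log-likelihood: `s` lists the indices of the `r₀` pilot draws, and `π₀` is
the pilot sampling distribution. -/
def pilotLogLik {r₀ : ℕ} (π₀ : Fin n → ℝ) (d : Dataset p n) (s : Fin r₀ → Fin n)
    (β : EuclideanSpace ℝ (Fin p)) : ℝ :=
  (r₀ : ℝ)⁻¹ * ∑ k, (π₀ (s k))⁻¹ * logTerm F (d (s k)) β

/-- The pilot estimate
`(n r₀)⁻¹ ∑ₖ π₀(sₖ)⁻¹ ψ''(βᵀx_{sₖ}) x_{sₖ} x_{sₖ}ᵀ` of the information matrix. -/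
def pilotInfoMatrix {r₀ : ℕ} (π₀ : Fin n → ℝ) (d : Dataset p n) (s : Fin r₀ → Fin n)
    (β : EuclideanSpace ℝ (Fin p)) : Matrix (Fin p) (Fin p) ℝ :=
  ((n : ℝ) * r₀)⁻¹ • ∑ k, ((π₀ (s k))⁻¹ * deriv (deriv F.ψ) (inner ℝ β (d (s k)).1)) •
    Matrix.vecMulVec (d (s k)).1.ofLp (d (s k)).1.ofLp

/-- The two optimality criteria. -/
inductive Criterion where
  | mV
  | mVc

/-- Unnormalized second-step weights: `max(|yᵢ - ψ'(bᵀxᵢ)|, δ)` times `‖J⁻¹ xᵢ‖` for mV, and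
times `‖xᵢ‖` for mVc; here `b` is the pilot estimate and `J` the pilot information matrix. -/
def optWeight (c : Criterion) (δ : ℝ) (d : Dataset p n) (J : Matrix (Fin p) (Fin p) ℝ)
    (b : EuclideanSpace ℝ (Fin p)) (i : Fin n) : ℝ :=
  max |(d i).2 - deriv F.ψ (inner ℝ b (d i).1)| δ *
    match c with
    | .mV => ‖WithLp.toLp 2 (J⁻¹.mulVec (d i).1.ofLp)‖
    | .mVc => ‖(d i).1‖

/-- The weights of the second step when the pilot indices are `s` and the pilot estimate is `b`. -/
def stepTwoWeight {r₀ : ℕ} (c : Criterion) (δ : ℝ) (π₀ : Fin n → ℝ) (d : Dataset p n)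
    (s : Fin r₀ → Fin n) (b : EuclideanSpace ℝ (Fin p)) : Fin n → ℝ :=
  optWeight F c δ d (pilotInfoMatrix F π₀ d s b) b

/-- The approximately optimal subsampling probabilities of the second step. -/
def stepTwoProb {r₀ : ℕ} (c : Criterion) (δ : ℝ) (π₀ : Fin n → ℝ) (d : Dataset p n)
    (s : Fin r₀ → Fin n) (b : EuclideanSpace ℝ (Fin p)) (i : Fin n) : ℝ :=
  stepTwoWeight F c δ π₀ d s b i / ∑ j, stepTwoWeight F c δ π₀ d s b j

/-- The weighted log-likelihood of the combined subsample: pilot draws `s` with sampling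
probabilities `π₀`, second-step draws `t` with sampling probabilities `π₁`. -/
def twoStepLogLik {r₀ r : ℕ} (π₀ π₁ : Fin n → ℝ) (d : Dataset p n) (s : Fin r₀ → Fin n)
    (t : Fin r → Fin n) (β : EuclideanSpace ℝ (Fin p)) : ℝ :=
  ((r : ℝ) + r₀)⁻¹ * (∑ k, (π₀ (s k))⁻¹ * logTerm F (d (s k)) β +
    ∑ k, (π₁ (t k))⁻¹ * logTerm F (d (t k)) β)

/-- The law of `r` independent draws, with replacement, from `{1, …, n}` with probabilities `π`. -/
def drawLaw (π : Fin n → ℝ) (r : ℕ) : Measure (Fin r → Fin n) :=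
  Measure.pi fun _ => ∑ i, ENNReal.ofReal (π i) • Measure.dirac i

/-- The conditional probability, given the data `d`, that the two-step estimator is at distance at
least `ρ` from `b`: the pilot indices `s` are drawn from `π₀`, and, given `s`, the second-step
indices are drawn from the approximately optimal probabilities. If these probabilities are
undefined (all weights vanish, as they do by convention when criterion mV meets a singular pilot
information matrix), the algorithm has failed and this counts in full. -/
def errorProb (c : Criterion) (δ : ℝ) (π₀ : Fin n → ℝ) (d : Dataset p n) (r₀ r : ℕ)
    (pilot : (Fin r₀ → Fin n) → EuclideanSpace ℝ (Fin p))
    (est : (Fin r₀ → Fin n) → (Fin r → Fin n) → EuclideanSpace ℝ (Fin p))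
    (b : EuclideanSpace ℝ (Fin p)) (ρ : ℝ) : ℝ≥0∞ :=
  ∫⁻ s, (if ∑ j, stepTwoWeight F c δ π₀ d s (pilot s) j = 0 then 1
    else drawLaw (stepTwoProb F c δ π₀ d s (pilot s)) r {t | ρ ≤ ‖est s t - b‖})
    ∂(drawLaw π₀ r₀)

end Likelihood

/-- The first `n` observations as a data set. -/
def sample {p : ℕ} {Ω : Type*} (X : ℕ → Ω → EuclideanSpace ℝ (Fin p)) (Y : ℕ → Ω → ℝ) (n : ℕ)
    (ω : Ω) : Dataset p n :=
  fun i => (X i ω, Y i ω)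

end GLMSubsampling

end

open GLMSubsampling

/-! The linear predictors stay in a compact interval inside the interior of the natural parameter
space, and there `ψ''` has a positive minimum `κ` unless the family is degenerate, which (H.4)
excludes. Hence each log-likelihood term is strongly concave in its linear predictor. Comparing the
two-step objective at its maximizer and at the MLE gives a deterministic inequality
(`RegularDomain.norm_sub_le`): once the second-step weighted means of the covariate products are
accurate enough to preserve curvature, the distance is at most a constant times `r₀ / r * D₀ + D₁`.
Here `D₀` and `D₁` bound the deviations of the pilot and second-step weighted means of the score at
the MLE from its population mean.

Given the data, these deviations are controlled by Chebyshev's inequality. In the second step the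
weights are comparable to the truncated residual times `‖x‖` (`stepTwoWeight_bounds`). Truncation at
`δ` makes this dominate the score at the MLE wherever the pilot estimate lies in the parameter
domain, so `D₁` is of order `r^(-1/2)` and consistency of the pilot is not needed. If `n π₀ᵢ ≥ 1 /
C`, the pilot score deviation is of order `√(C / r₀)`; multiplied by `r₀ / r` it becomes `√(C r₀ /
r) * r^(-1/2)`, which is negligible. This is why the radius in `exists_errorProb_lt` is fixed before
`C`, while `C` only affects how large `n` and `r` must be.

The randomness of the data enters only through the bound on `n π₀ᵢ` and through the event
`GoodData`, whose probability tends to one (`exists_regularDomain_and_goodData`). Neither event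
involves `r`, so all large `r` are handled at once without a union bound over `r`. -/

namespace GLMSubsampling

/-! ### Chebyshev's inequality for inverse-probability weighting -/

section Sampling

variable {n : ℕ}

/-- The average of a feature `f` over the population `{1, …, n}`. -/
noncomputable def popMean (f : Fin n → ℝ) : ℝ := (n : ℝ)⁻¹ * ∑ i, f i

/-- The inverse-probability weighted (Hansen–Hurwitz) estimate of `popMean f` from the draws `t`. -/
noncomputable def weightedMean {r : ℕ} (π : Fin n → ℝ) (t : Fin r → Fin n) (f : Fin n → ℝ) : ℝ :=
  (r : ℝ)⁻¹ * ∑ k, (n * π (t k))⁻¹ * f (t k)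

/-- The law of one draw from `{1, …, n}` with probabilities `π`. -/
noncomputable def singleLaw (π : Fin n → ℝ) : Measure (Fin n) :=
  ∑ i, ENNReal.ofReal (π i) • Measure.dirac i

lemma isProbabilityMeasure_singleLaw {π : Fin n → ℝ} (h0 : ∀ i, 0 ≤ π i) (h1 : ∑ i, π i = 1) :
    IsProbabilityMeasure (singleLaw π) := by
  constructor
  simp only [singleLaw, Measure.finsetSum_apply, Measure.smul_apply, measure_univ, smul_eq_mul,
    mul_one]
  rw [← ENNReal.ofReal_sum_of_nonneg fun i _ => h0 i, h1, ENNReal.ofReal_one]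

lemma isProbabilityMeasure_drawLaw {π : Fin n → ℝ} (h0 : ∀ i, 0 ≤ π i) (h1 : ∑ i, π i = 1)
    (r : ℕ) : IsProbabilityMeasure (drawLaw π r) := by
  have := isProbabilityMeasure_singleLaw h0 h1
  unfold drawLaw
  change IsProbabilityMeasure (Measure.pi fun _ : Fin r => singleLaw π)
  infer_instance

lemma integral_singleLaw {π : Fin n → ℝ} (h0 : ∀ i, 0 ≤ π i) (f : Fin n → ℝ) :
    ∫ i, f i ∂(singleLaw π) = ∑ i, π i * f i := by
  unfold singleLaw
  rw [integral_finsetSum_measure]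
  · refine Finset.sum_congr rfl fun i _ => ?_
    rw [integral_smul_measure, integral_dirac, ENNReal.toReal_ofReal (h0 i), smul_eq_mul]
  · intro i _
    exact (integrable_dirac (by simp)).smul_measure (by simp)

/-- Chebyshev's inequality for inverse-probability weighted means. -/
lemma drawLaw_weightedMean_le {π : Fin n → ℝ} (h0 : ∀ i, 0 ≤ π i) (h1 : ∑ i, π i = 1)
    {f : Fin n → ℝ} (hf : ∀ i, π i = 0 → f i = 0) {r : ℕ} (hr : 0 < r) {V : ℝ}
    (hV : ((n : ℝ)⁻¹) ^ 2 * ∑ i, (π i)⁻¹ * f i ^ 2 ≤ V) {D : ℝ} (hD : 0 < D) :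
    drawLaw π r {t | D ≤ |weightedMean π t f - popMean f|} ≤ ENNReal.ofReal (V / (r * D ^ 2)) := by
  have hP := isProbabilityMeasure_singleLaw h0 h1
  have hrR : (0 : ℝ) < r := by exact_mod_cast hr
  let g : Fin n → ℝ := fun i => (r : ℝ)⁻¹ * ((n * π i)⁻¹ * f i)
  have hg : MemLp g 2 (singleLaw π) := by
    refine MemLp.of_bound (C := ∑ i, ‖g i‖) (measurable_of_finite g).aestronglyMeasurable ?_
    exact .of_forall fun i => Finset.single_le_sum (f := fun i => ‖g i‖)
      (fun _ _ => norm_nonneg _) (Finset.mem_univ i)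
  have hmean : ∫ i, g i ∂(singleLaw π) = (r : ℝ)⁻¹ * popMean f := by
    rw [integral_singleLaw h0, popMean, Finset.mul_sum, Finset.mul_sum]
    refine Finset.sum_congr rfl fun i _ => ?_
    -- An index with `π i = 0` is never drawn, and the inverse is `0` by convention; `hf` makes the
    -- term missing from the population mean vanish as well.
    by_cases h : π i = 0
    · simp [h, hf i h]
    · simp only [g, mul_inv]; field_simp
  -- Centering is discarded: the raw second moment is enough for the rate.
  have hvar : Var[g; singleLaw π] ≤ ((r : ℝ)⁻¹) ^ 2 * V := by
    refine (variance_le_expectation_sq hg.aestronglyMeasurable).trans ?_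
    simp only [Pi.pow_apply]
    rw [integral_singleLaw h0]
    refine le_trans (le_of_eq ?_) (mul_le_mul_of_nonneg_left hV (by positivity))
    rw [Finset.mul_sum, Finset.mul_sum]
    refine Finset.sum_congr rfl fun i _ => ?_
    by_cases h : π i = 0
    · simp [h]
    · simp only [g, mul_inv]; field_simp
  let W : (Fin r → Fin n) → ℝ := ∑ k, fun t => g (t k)
  have hW : ∀ t, W t = weightedMean π t f := by
    intro t
    simp only [W, Finset.sum_apply, g, weightedMean, Finset.mul_sum]
  have hWm : MemLp W 2 (Measure.pi fun _ : Fin r => singleLaw π) :=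
    memLp_finsetSum' _ fun k _ => hg.comp_measurePreserving (measurePreserving_eval _ k)
  have hWi : ∫ t, W t ∂(Measure.pi fun _ : Fin r => singleLaw π) = popMean f := by
    simp only [W, Finset.sum_apply]
    rw [integral_finsetSum]
    · simp_rw [integral_comp_eval (μ := fun _ : Fin r => singleLaw π)
        (hg.aestronglyMeasurable), hmean]
      simp; field_simp
    · exact fun k _ => (hg.comp_measurePreserving (measurePreserving_eval _ k)).integrable
        (by norm_num)
  have hWv : Var[W; Measure.pi fun _ : Fin r => singleLaw π] ≤ V / r := by
    rw [variance_sum_pi (fun _ => hg)]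
    simp only [Finset.sum_const, Finset.card_univ, Fintype.card_fin, nsmul_eq_mul]
    refine (mul_le_mul_of_nonneg_left hvar hrR.le).trans (le_of_eq ?_)
    field_simp
  have := meas_ge_le_variance_div_sq hWm hD
  rw [hWi] at this
  simp only [hW] at this
  refine this.trans (ENNReal.ofReal_le_ofReal ?_)
  rw [← div_div]
  gcongr

end Sampling

end GLMSubsampling

/-! ### Strong convexity of the log-partition function -/

namespace GLMSubsampling

namespace ExpFamily

variable (F : ExpFamily) {a b : ℝ}

lemma integrable_exp_of_mem {θ : ℝ} (h : θ ∈ F.naturalSpace) :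
    Integrable (fun y => Real.exp (θ * y)) F.base := h

lemma analyticOnNhd_ψ : AnalyticOnNhd ℝ F.ψ (interior F.naturalSpace) :=
  fun _ h => analyticAt_cgf h

lemma analyticOnNhd_deriv_ψ : AnalyticOnNhd ℝ (deriv F.ψ) (interior F.naturalSpace) :=
  F.analyticOnNhd_ψ.deriv

lemma analyticOnNhd_deriv_deriv_ψ :
    AnalyticOnNhd ℝ (deriv (deriv F.ψ)) (interior F.naturalSpace) :=
  F.analyticOnNhd_deriv_ψ.deriv

lemma deriv_deriv_ψ_eq {θ : ℝ} (h : θ ∈ interior F.naturalSpace) :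
    deriv (deriv F.ψ) θ =
      (∫ y, (y - deriv F.ψ θ) ^ 2 * Real.exp (θ * y) ∂F.base) / mgf id F.base θ := by
  have := iteratedDeriv_two_cgf_eq_integral (X := id) (μ := F.base) h
  rw [iteratedDeriv_succ, iteratedDeriv_one] at this
  exact this

lemma integrable_sq_sub_mul_exp {θ : ℝ} (h : θ ∈ interior F.naturalSpace) (c : ℝ) :
    Integrable (fun y => (y - c) ^ 2 * Real.exp (θ * y)) F.base := by
  have h0 := integrable_pow_mul_exp_of_mem_interior_integrableExpSet h 0
  have h1 := integrable_pow_mul_exp_of_mem_interior_integrableExpSet h 1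
  have h2 := integrable_pow_mul_exp_of_mem_interior_integrableExpSet h 2
  simp only [id] at h0 h1 h2
  refine ((h2.sub (h1.const_mul (2 * c))).add (h0.const_mul (c ^ 2))).congr ?_
  exact .of_forall fun y => by simp; ring

lemma deriv_deriv_ψ_nonneg {θ : ℝ} (h : θ ∈ interior F.naturalSpace) :
    0 ≤ deriv (deriv F.ψ) θ := by
  rw [F.deriv_deriv_ψ_eq h]
  exact div_nonneg (integral_nonneg fun y => by positivity) mgf_nonneg

/-- If `ψ''` vanishes at one interior point then the family is degenerate, and `ψ''` vanishes
throughout the interior of the natural parameter space. -/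
lemma deriv_deriv_ψ_eq_zero {θ θ' : ℝ} (h : θ ∈ interior F.naturalSpace)
    (h0 : deriv (deriv F.ψ) θ = 0) (h' : θ' ∈ interior F.naturalSpace) :
    deriv (deriv F.ψ) θ' = 0 := by
  by_cases hb : F.base = 0
  · rw [F.deriv_deriv_ψ_eq h', hb]; simp
  have hpos : 0 < mgf id F.base θ := mgf_pos' hb (F.integrable_exp_of_mem (interior_subset h))
  rw [F.deriv_deriv_ψ_eq h, div_eq_zero_iff, or_iff_left hpos.ne',
    integral_eq_zero_iff_of_nonneg (fun y => by positivity) (F.integrable_sq_sub_mul_exp h _)] at h0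
  set c := deriv F.ψ θ
  -- Exponential tilts are strictly positive, so zero variance at one parameter already concentrates
  -- the untilted measure at `c`, and with it every other tilt.
  have hc : ∀ᵐ y ∂F.base, y = c := by
    filter_upwards [h0] with y hy
    simpa [sub_eq_zero, Real.exp_ne_zero] using hy
  have hmgf : 0 < mgf id F.base θ' := mgf_pos' hb (F.integrable_exp_of_mem (interior_subset h'))
  have hd : deriv F.ψ θ' = c := by
    have : deriv F.ψ θ' = (∫ y, y * Real.exp (θ' * y) ∂F.base) / mgf id F.base θ' :=
      deriv_cgf (X := id) h'
    rw [this, div_eq_iff hmgf.ne', mgf, ← integral_const_mul]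
    refine integral_congr_ae ?_
    filter_upwards [hc] with y hy
    simp [hy]
  rw [F.deriv_deriv_ψ_eq h', hd, integral_eq_zero_of_ae, zero_div]
  filter_upwards [hc] with y hy
  simp [hy]

/-- Bounds for the derivatives of `ψ` on a compact interval. -/
lemma exists_deriv_bounds (hab : Set.Icc a b ⊆ interior F.naturalSpace) :
    ∃ K : ℝ, 0 < K ∧ ∀ θ ∈ Set.Icc a b, |F.ψ θ| ≤ K ∧ |deriv F.ψ θ| ≤ K ∧
      deriv (deriv F.ψ) θ ≤ K := by
  obtain ⟨K₀, h₀⟩ := isCompact_Icc.exists_bound_of_continuousOn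
    (F.analyticOnNhd_ψ.continuousOn.mono hab)
  obtain ⟨K₁, h₁⟩ := isCompact_Icc.exists_bound_of_continuousOn
    (F.analyticOnNhd_deriv_ψ.continuousOn.mono hab)
  obtain ⟨K₂, h₂⟩ := isCompact_Icc.exists_bound_of_continuousOn
    (F.analyticOnNhd_deriv_deriv_ψ.continuousOn.mono hab)
  refine ⟨|K₀| + |K₁| + |K₂| + 1, by positivity, fun θ hθ => ⟨?_, ?_, ?_⟩⟩
  · have := h₀ θ hθ
    rw [Real.norm_eq_abs] at this
    linarith [le_abs_self K₀, abs_nonneg K₁, abs_nonneg K₂]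
  · have := h₁ θ hθ
    rw [Real.norm_eq_abs] at this
    linarith [le_abs_self K₁, abs_nonneg K₀, abs_nonneg K₂]
  · have := h₂ θ hθ
    rw [Real.norm_eq_abs] at this
    linarith [le_abs_self K₂, abs_nonneg K₀, abs_nonneg K₁, le_abs_self (deriv (deriv F.ψ) θ)]

/-- The minimum of `ψ''` over the compact interval is attained, and the value zero would force
degeneracy; so one nonzero value, possibly outside the interval, suffices. -/
lemma exists_pos_le_deriv_deriv (hab : Set.Icc a b ⊆ interior F.naturalSpace)
    (hne : ∃ θ ∈ interior F.naturalSpace, deriv (deriv F.ψ) θ ≠ 0) :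
    ∃ κ : ℝ, 0 < κ ∧ ∀ θ ∈ Set.Icc a b, κ ≤ deriv (deriv F.ψ) θ := by
  rcases (Set.Icc a b).eq_empty_or_nonempty with he | hn
  · exact ⟨1, one_pos, by simp [he]⟩
  obtain ⟨θ₀, hθ₀, hmin⟩ := isCompact_Icc.exists_isMinOn hn
    (F.analyticOnNhd_deriv_deriv_ψ.continuousOn.mono hab)
  refine ⟨_, lt_of_le_of_ne (F.deriv_deriv_ψ_nonneg (hab hθ₀)) fun h => ?_, fun θ hθ => hmin hθ⟩
  obtain ⟨θ, hθ, hθ'⟩ := hne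
  exact hθ' (F.deriv_deriv_ψ_eq_zero (hab hθ₀) h.symm hθ)

/-- Strong convexity of `ψ`, in tangent-line form. -/
lemma ψ_tangent_le (hab : Set.Icc a b ⊆ interior F.naturalSpace) {κ : ℝ}
    (hκ : ∀ θ ∈ Set.Icc a b, κ ≤ deriv (deriv F.ψ) θ) {θ θ' : ℝ} (hθ : θ ∈ Set.Icc a b)
    (hθ' : θ' ∈ Set.Icc a b) :
    F.ψ θ + deriv F.ψ θ * (θ' - θ) + κ / 2 * (θ' - θ) ^ 2 ≤ F.ψ θ' := by
  -- Removing the quadratic leaves a convex function, whose tangent-line inequality is the claim.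
  set g : ℝ → ℝ := fun u => F.ψ u - κ / 2 * u ^ 2 with hg
  have hd : ∀ u ∈ interior F.naturalSpace, HasDerivAt g (deriv F.ψ u - κ * u) u := by
    intro u hu
    have h1 := (F.analyticOnNhd_ψ u hu).differentiableAt.hasDerivAt
    have h2 := ((hasDerivAt_id u).pow 2).const_mul (κ / 2)
    refine (h1.sub h2).congr_deriv ?_
    simp only [id, pow_one, Nat.cast_ofNat, Nat.add_one_sub_one]; ring
  have hd2 : ∀ u ∈ interior F.naturalSpace,
      HasDerivAt (deriv g) (deriv (deriv F.ψ) u - κ) u := by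
    intro u hu
    have h1 := (F.analyticOnNhd_deriv_ψ u hu).differentiableAt.hasDerivAt
    have h2 := (hasDerivAt_id u).const_mul κ
    have h3 : HasDerivAt (fun u => deriv F.ψ u - κ * u) (deriv (deriv F.ψ) u - κ) u :=
      (h1.sub h2).congr_deriv (by ring)
    refine h3.congr_of_eventuallyEq ?_
    filter_upwards [isOpen_interior.mem_nhds hu] with v hv using (hd v hv).deriv
  have hsub : interior (Set.Icc a b) ⊆ interior F.naturalSpace := interior_subset.trans hab
  have hconv : ConvexOn ℝ (Set.Icc a b) g := by
    refine convexOn_of_deriv2_nonneg (convex_Icc a b)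
      (fun u hu => (hd u (hab hu)).continuousAt.continuousWithinAt)
      (fun u hu => (hd u (hsub hu)).differentiableAt.differentiableWithinAt)
      (fun u hu => (hd2 u (hsub hu)).differentiableAt.differentiableWithinAt) fun u hu => ?_
    simp only [Function.iterate_succ, Function.iterate_zero, Function.comp_apply, id]
    rw [(hd2 u (hsub hu)).deriv]
    linarith [hκ u (interior_subset hu)]
  have key : g θ + (deriv F.ψ θ - κ * θ) * (θ' - θ) ≤ g θ' := by
    rcases lt_trichotomy θ θ' with h | h | h
    · have := hconv.le_slope_of_hasDerivAt hθ hθ' h (hd θ (hab hθ))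
      rw [slope_def_field, le_div_iff₀ (by linarith)] at this
      linarith
    · subst h; simp
    · have := hconv.slope_le_of_hasDerivAt hθ' hθ h (hd θ (hab hθ))
      rw [slope_def_field, div_le_iff₀ (by linarith)] at this
      linarith
  simp only [hg] at key
  nlinarith [key]

end ExpFamily

/-- The linear predictors `βᵀx`, over the parameter domain and the cube `[-L, L]ᵖ`, lie in a compact
interval inside the interior of the natural parameter space. -/
lemma exists_Icc_predictors (F : ExpFamily) {p : ℕ} {L B : ℝ} (hL : 0 < L)
    (H2 : ∀ β ∈ paramDomain F p L B, ∀ x : EuclideanSpace ℝ (Fin p), (∀ j, |x j| ≤ L) →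
      inner ℝ β x ∈ interior F.naturalSpace)
    (H3c : IsCompact (paramDomain F p L B)) (hne : (paramDomain F p L B).Nonempty) :
    ∃ a b : ℝ, Set.Icc a b ⊆ interior F.naturalSpace ∧
      ∀ β ∈ paramDomain F p L B, ∀ x : EuclideanSpace ℝ (Fin p), ‖x‖ ≤ L →
        inner ℝ β x ∈ Set.Icc a b := by
  set T : Set ℝ := (fun q : EuclideanSpace ℝ (Fin p) × EuclideanSpace ℝ (Fin p) =>
    (inner ℝ q.1 q.2 : ℝ)) '' (paramDomain F p L B ×ˢ Metric.closedBall 0 L) with hT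
  have hTc : IsCompact T :=
    (H3c.prod (isCompact_closedBall 0 L)).image (by fun_prop)
  have hTn : T.Nonempty := by
    obtain ⟨β, hβ⟩ := hne
    exact ⟨_, (β, 0), ⟨hβ, by simp [hL.le]⟩, rfl⟩
  have hTi : T ⊆ interior F.naturalSpace := by
    rintro _ ⟨⟨β, x⟩, ⟨hβ, hx⟩, rfl⟩
    refine H2 β hβ x fun j => ?_
    have := PiLp.norm_apply_le x j
    rw [Real.norm_eq_abs] at this
    exact this.trans (by simpa using hx)
  -- By compactness both endpoints belong to `T`, hence to the interior of the natural space;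
  -- convexity of that interior fills in the interval.
  refine ⟨sInf T, sSup T, ?_, fun β hβ x hx => ?_⟩
  · exact (convex_integrableExpSet.interior).ordConnected.out (hTi (hTc.sInf_mem hTn))
      (hTi (hTc.sSup_mem hTn))
  · have hm : inner ℝ β x ∈ T := ⟨(β, x), ⟨hβ, by simpa using hx⟩, rfl⟩
    exact ⟨csInf_le hTc.bddBelow hm, le_csSup hTc.bddAbove hm⟩

lemma convex_paramDomain (F : ExpFamily) (p : ℕ) (L B : ℝ) : Convex ℝ (paramDomain F p L B) := by
  intro β hβ γ hγ s t hs ht hst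
  refine ⟨fun x hx => ?_, ?_⟩
  · rw [inner_add_left, real_inner_smul_left, real_inner_smul_left]
    exact convex_integrableExpSet (hβ.1 x hx) (hγ.1 x hx) hs ht hst
  · have := convex_closedBall (0 : EuclideanSpace ℝ (Fin p)) B
    have h := this (x := β) (by simpa using hβ.2) (y := γ) (by simpa using hγ.2) hs ht hst
    simpa using h

end GLMSubsampling

/-! ### Linear algebra of population means and weighted means -/

namespace GLMSubsampling

section Means

variable {n : ℕ}

lemma popMean_mono {f g : Fin n → ℝ} (h : ∀ i, f i ≤ g i) : popMean f ≤ popMean g :=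
  mul_le_mul_of_nonneg_left (Finset.sum_le_sum fun i _ => h i) (by positivity)

lemma popMean_const (hn : 0 < n) (c : ℝ) : popMean (fun _ : Fin n => c) = c := by
  have : (n : ℝ) ≠ 0 := by exact_mod_cast hn.ne'
  simp [popMean, this]

lemma popMean_const_mul (c : ℝ) (f : Fin n → ℝ) :
    popMean (fun i => c * f i) = c * popMean f := by
  simp only [popMean, ← Finset.mul_sum]; ring

lemma popMean_add (f g : Fin n → ℝ) :
    popMean (fun i => f i + g i) = popMean f + popMean g := by
  simp only [popMean, Finset.sum_add_distrib]; ring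

lemma popMean_sum {ι : Type*} (s : Finset ι) (c : ι → ℝ) (f : ι → Fin n → ℝ) :
    popMean (fun i => ∑ a ∈ s, c a * f a i) = ∑ a ∈ s, c a * popMean (f a) := by
  simp only [popMean]
  rw [Finset.sum_comm]
  simp only [Finset.mul_sum]
  exact Finset.sum_congr rfl fun _ _ => Finset.sum_congr rfl fun _ _ => by ring

variable {r : ℕ} {π : Fin n → ℝ} (t : Fin r → Fin n)

lemma weightedMean_mono (h0 : ∀ i, 0 ≤ π i) {f g : Fin n → ℝ} (h : ∀ i, f i ≤ g i) :
    weightedMean π t f ≤ weightedMean π t g := by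
  refine mul_le_mul_of_nonneg_left (Finset.sum_le_sum fun k _ => ?_) (by positivity)
  have := h0 (t k)
  exact mul_le_mul_of_nonneg_left (h _) (by positivity)

lemma weightedMean_const_mul (c : ℝ) (f : Fin n → ℝ) :
    weightedMean π t (fun i => c * f i) = c * weightedMean π t f := by
  simp only [weightedMean, Finset.mul_sum]
  exact Finset.sum_congr rfl fun _ _ => by ring

lemma weightedMean_sub (f g : Fin n → ℝ) :
    weightedMean π t (fun i => f i - g i) = weightedMean π t f - weightedMean π t g := by
  simp only [weightedMean, mul_sub, Finset.sum_sub_distrib]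

lemma weightedMean_sum {ι : Type*} (s : Finset ι) (c : ι → ℝ) (f : ι → Fin n → ℝ) :
    weightedMean π t (fun i => ∑ a ∈ s, c a * f a i) = ∑ a ∈ s, c a * weightedMean π t (f a) := by
  simp only [weightedMean, Finset.mul_sum]
  rw [Finset.sum_comm]
  exact Finset.sum_congr rfl fun _ _ => Finset.sum_congr rfl fun _ _ => by ring

/-- Finitely many deviations control all linear combinations, uniformly in the coefficients. This
allows the direction from the MLE to the estimator, which depends on the draws themselves. -/
lemma abs_weightedMean_sub_popMean_le {ι : Type*} (s : Finset ι) (c : ι → ℝ)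
    (f : ι → Fin n → ℝ) {D : ℝ} (h : ∀ a ∈ s, |weightedMean π t (f a) - popMean (f a)| ≤ D) :
    |weightedMean π t (fun i => ∑ a ∈ s, c a * f a i) - popMean (fun i => ∑ a ∈ s, c a * f a i)| ≤
      (∑ a ∈ s, |c a|) * D := by
  rw [weightedMean_sum, popMean_sum, ← Finset.sum_sub_distrib, Finset.sum_mul]
  refine (Finset.abs_sum_le_sum_abs _ _).trans (Finset.sum_le_sum fun a ha => ?_)
  rw [← mul_sub, abs_mul]
  exact mul_le_mul_of_nonneg_left (h a ha) (abs_nonneg _)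

end Means

section Euclidean

variable {p n : ℕ}

lemma inner_eq_sum_mul (v x : EuclideanSpace ℝ (Fin p)) : inner ℝ v x = ∑ j, v j * x j := by
  rw [PiLp.inner_apply]
  exact Finset.sum_congr rfl fun j _ => by simp [mul_comm]

lemma abs_apply_le_norm (v : EuclideanSpace ℝ (Fin p)) (j : Fin p) : |v j| ≤ ‖v‖ := by
  simpa using PiLp.norm_apply_le v j

lemma sum_abs_apply_le (v : EuclideanSpace ℝ (Fin p)) : ∑ j, |v j| ≤ p * ‖v‖ := by
  calc ∑ j, |v j| ≤ ∑ _j : Fin p, ‖v‖ := Finset.sum_le_sum fun j _ => abs_apply_le_norm v j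
    _ = p * ‖v‖ := by simp

lemma sum_abs_mul_apply_le (v : EuclideanSpace ℝ (Fin p)) :
    ∑ q : Fin p × Fin p, |v q.1 * v q.2| ≤ p ^ 2 * ‖v‖ ^ 2 := by
  simp only [abs_mul]
  rw [← Finset.univ_product_univ, Finset.sum_product]
  simp only
  rw [← Finset.sum_mul_sum, ← sq, ← mul_pow]
  exact pow_le_pow_left₀ (Finset.sum_nonneg fun _ _ => abs_nonneg _) (sum_abs_apply_le v) 2

/-- The product of coordinates `q.1` and `q.2` of the covariate. -/
noncomputable def coordProd (d : Dataset p n) (q : Fin p × Fin p) (i : Fin n) : ℝ :=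
  (d i).1 q.1 * (d i).1 q.2

lemma inner_mul_inner_eq_sum (d : Dataset p n) (v w : EuclideanSpace ℝ (Fin p)) (i : Fin n) :
    inner ℝ v (d i).1 * inner ℝ w (d i).1 =
      ∑ q : Fin p × Fin p, (v q.1 * w q.2) * coordProd d q i := by
  rw [inner_eq_sum_mul, inner_eq_sum_mul, Finset.sum_mul_sum, ← Finset.univ_product_univ,
    Finset.sum_product]
  exact Finset.sum_congr rfl fun _ _ => Finset.sum_congr rfl fun _ _ => by
    simp only [coordProd]; ring

lemma norm_sq_eq_sum_coordProd (d : Dataset p n) (i : Fin n) :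
    ‖(d i).1‖ ^ 2 = ∑ a : Fin p, 1 * coordProd d (a, a) i := by
  rw [← real_inner_self_eq_norm_sq, inner_eq_sum_mul]
  simp [coordProd]

lemma abs_coordProd_le (d : Dataset p n) (q : Fin p × Fin p) (i : Fin n) :
    |coordProd d q i| ≤ ‖(d i).1‖ ^ 2 := by
  rw [coordProd, abs_mul, sq]
  exact mul_le_mul (abs_apply_le_norm _ _) (abs_apply_le_norm _ _) (abs_nonneg _) (norm_nonneg _)

/-- Coordinate `j` of the score contributed by observation `i`. -/
noncomputable def score (F : ExpFamily) (d : Dataset p n) (β : EuclideanSpace ℝ (Fin p)) (j : Fin p)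
    (i : Fin n) : ℝ :=
  ((d i).2 - deriv F.ψ (inner ℝ β (d i).1)) * (d i).1 j

lemma score_inner_eq_sum (F : ExpFamily) (d : Dataset p n) (β v : EuclideanSpace ℝ (Fin p))
    (i : Fin n) :
    ((d i).2 - deriv F.ψ (inner ℝ β (d i).1)) * inner ℝ v (d i).1 =
      ∑ j, v j * score F d β j i := by
  rw [inner_eq_sum_mul v, Finset.mul_sum]
  exact Finset.sum_congr rfl fun _ _ => by simp only [score]; ring

end Euclidean

/-- Uniform regularity of the log-partition function `ψ` at the linear predictors `βᵀx` with
`β ∈ S` and `‖x‖ ≤ L`. -/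
structure RegularDomain (F : ExpFamily) {p : ℕ} (S : Set (EuclideanSpace ℝ (Fin p)))
    (L κ K : ℝ) : Prop where
  L_pos : 0 < L
  κ_pos : 0 < κ
  K_pos : 0 < K
  convex : Convex ℝ S
  differentiableAt : ∀ β ∈ S, ∀ x : EuclideanSpace ℝ (Fin p), ‖x‖ ≤ L →
    DifferentiableAt ℝ F.ψ (inner ℝ β x)
  tangent : ∀ β ∈ S, ∀ γ ∈ S, ∀ x : EuclideanSpace ℝ (Fin p), ‖x‖ ≤ L →
    F.ψ (inner ℝ β x) + deriv F.ψ (inner ℝ β x) * inner ℝ (γ - β) x +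
      κ / 2 * (inner ℝ (γ - β) x) ^ 2 ≤ F.ψ (inner ℝ γ x)
  abs_deriv_le : ∀ β ∈ S, ∀ x : EuclideanSpace ℝ (Fin p), ‖x‖ ≤ L →
    |deriv F.ψ (inner ℝ β x)| ≤ K
  le_deriv_deriv : ∀ β ∈ S, ∀ x : EuclideanSpace ℝ (Fin p), ‖x‖ ≤ L →
    κ ≤ deriv (deriv F.ψ) (inner ℝ β x)
  deriv_deriv_le : ∀ β ∈ S, ∀ x : EuclideanSpace ℝ (Fin p), ‖x‖ ≤ L →
    deriv (deriv F.ψ) (inner ℝ β x) ≤ K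

/-- Data with bounded covariates, bounded second moment of the responses and a uniformly positive
definite design. -/
structure GoodData {p n : ℕ} (d : Dataset p n) (L A lam : ℝ) : Prop where
  norm_le : ∀ i, ‖(d i).1‖ ≤ L
  sq_le : popMean (fun i => (d i).2 ^ 2) ≤ A
  le_quad : ∀ v : EuclideanSpace ℝ (Fin p),
    lam * ‖v‖ ^ 2 ≤ popMean fun i => inner ℝ v (d i).1 * inner ℝ v (d i).1

/-! ### Deterministic stability of the maximizer -/

section Deterministic

variable {p n : ℕ} {F : ExpFamily} {S : Set (EuclideanSpace ℝ (Fin p))} {L κ K A lam : ℝ}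
  {d : Dataset p n}

/-- The tolerance `lam / (2 * p ^ 2)` per entry costs at most `lam / 2 * ‖v‖ ^ 2`, because `∑ |v j *
v k| ≤ p ^ 2 * ‖v‖ ^ 2`; half of the coercivity survives. -/
lemma le_weightedMean_quad (hp : 0 < p) (hd : GoodData d L A lam) {r : ℕ}
    {π : Fin n → ℝ} {t : Fin r → Fin n}
    (ht : ∀ q, |weightedMean π t (coordProd d q) - popMean (coordProd d q)| ≤
      lam / (2 * p ^ 2)) (v : EuclideanSpace ℝ (Fin p)) :
    lam / 2 * ‖v‖ ^ 2 ≤ weightedMean π t fun i => inner ℝ v (d i).1 * inner ℝ v (d i).1 := by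
  have hpR : (0 : ℝ) < p := by exact_mod_cast hp
  have h1 := abs_weightedMean_sub_popMean_le (π := π) t Finset.univ
    (fun q : Fin p × Fin p => v q.1 * v q.2) (coordProd d) (fun q _ => ht q)
  simp only [← inner_mul_inner_eq_sum d v v] at h1
  have hτ : 0 ≤ lam / (2 * p ^ 2) := (abs_nonneg _).trans (ht (⟨0, hp⟩, ⟨0, hp⟩))
  have h3 := mul_le_mul_of_nonneg_right (sum_abs_mul_apply_le v) hτ
  have h4 : (p : ℝ) ^ 2 * ‖v‖ ^ 2 * (lam / (2 * p ^ 2)) = lam / 2 * ‖v‖ ^ 2 := by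
    field_simp
  have h5 := hd.le_quad v
  have h6 := (abs_le.1 h1).1
  linarith

namespace RegularDomain

/-- This is the tangent inequality for `ψ` at the predictor of `β`: the linear part is the score at
`β`, the quadratic part the curvature gain. -/
lemma logTerm_sub_le (hF : RegularDomain F S L κ K) {β γ : EuclideanSpace ℝ (Fin p)}
    (hβ : β ∈ S) (hγ : γ ∈ S) {z : EuclideanSpace ℝ (Fin p) × ℝ} (hz : ‖z.1‖ ≤ L) :
    logTerm F z γ - logTerm F z β ≤ (z.2 - deriv F.ψ (inner ℝ β z.1)) * inner ℝ (γ - β) z.1 -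
      κ / 2 * (inner ℝ (γ - β) z.1 * inner ℝ (γ - β) z.1) := by
  have h := hF.tangent β hβ γ hγ z.1 hz
  have h2 : inner ℝ (γ - β) z.1 = inner ℝ γ z.1 - (inner ℝ β z.1 : ℝ) := inner_sub_left _ _ _
  unfold logTerm
  rw [h2] at h ⊢
  nlinarith [h]

/-- First-order optimality condition for a maximizer of the full data log-likelihood. -/
lemma popMean_score_le_zero (hF : RegularDomain F S L κ K) (hd : ∀ i, ‖(d i).1‖ ≤ L)
    {β γ : EuclideanSpace ℝ (Fin p)} (hβ : IsMaximizer S (logLik F d) β) (hγ : γ ∈ S) :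
    popMean (fun i => ((d i).2 - deriv F.ψ (inner ℝ β (d i).1)) * inner ℝ (γ - β) (d i).1) ≤ 0 := by
  refine mul_nonpos_of_nonneg_of_nonpos (by positivity) ?_
  -- The maximizer may lie on the boundary of `S`, so the score need not vanish there; only the
  -- right derivative along the segment towards `γ` has a sign.
  set f : ℝ → ℝ := fun u => logLik F d (β + u • (γ - β)) with hf
  have hder : HasDerivAt f
      (∑ i, ((d i).2 - deriv F.ψ (inner ℝ β (d i).1)) * inner ℝ (γ - β) (d i).1) 0 := by
    simp only [hf, logLik]
    refine HasDerivAt.fun_sum fun i _ => ?_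
    have hlin : HasDerivAt (fun u : ℝ => inner ℝ (β + u • (γ - β)) (d i).1)
        (inner ℝ (γ - β) (d i).1) 0 := by
      simp only [inner_add_left, real_inner_smul_left]
      simpa using ((hasDerivAt_id (0 : ℝ)).mul_const (inner ℝ (γ - β) (d i).1)).const_add
        (inner ℝ β (d i).1)
    have hψ : HasDerivAt F.ψ (deriv F.ψ (inner ℝ β (d i).1))
        (inner ℝ (β + (0 : ℝ) • (γ - β)) (d i).1) := by
      simpa using (hF.differentiableAt β hβ.1 _ (hd i)).hasDerivAt
    have := (hlin.const_mul (d i).2).sub (hψ.comp (0 : ℝ) hlin)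
    refine this.congr_deriv (by ring)
  have hslope := hder.tendsto_slope_zero_right
  refine le_of_tendsto hslope ?_
  filter_upwards [Ioo_mem_nhdsGT (zero_lt_one' ℝ)] with u hu
  have hmem : β + u • (γ - β) ∈ S := hF.convex.add_smul_sub_mem hβ.1 hγ ⟨hu.1.le, hu.2.le⟩
  have := hβ.2 hmem
  simp only [zero_add, smul_eq_mul]
  refine mul_nonpos_of_nonneg_of_nonpos (inv_nonneg.2 hu.1.le) ?_
  simp only [hf, zero_smul, add_zero]
  exact sub_nonpos.2 this

/-- A maximizer of the two-step log-likelihood is close to the full data maximizer when the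
weighted means of the scores and of the covariate products are close to the population means. -/
lemma norm_sub_le (hp : 0 < p) (hF : RegularDomain F S L κ K) (hlam : 0 < lam)
    (hd : GoodData d L A lam) (hn : 0 < n) {r₀ r : ℕ} (hr : 0 < r) {π₀ π₁ : Fin n → ℝ}
    (h₀ : ∀ i, 0 ≤ π₀ i) (h₁ : ∀ i, 0 ≤ π₁ i) {s : Fin r₀ → Fin n} {t : Fin r → Fin n}
    {β γ : EuclideanSpace ℝ (Fin p)} (hβ : IsMaximizer S (logLik F d) β)
    (hγ : IsMaximizer S (twoStepLogLik F π₀ π₁ d s t) γ) {D₀ D₁ : ℝ}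
    (hs : ∀ j, |weightedMean π₀ s (score F d β j) - popMean (score F d β j)| ≤ D₀)
    (ht : ∀ j, |weightedMean π₁ t (score F d β j) - popMean (score F d β j)| ≤ D₁)
    (htq : ∀ q, |weightedMean π₁ t (coordProd d q) - popMean (coordProd d q)| ≤
      lam / (2 * p ^ 2)) :
    ‖γ - β‖ ≤ 4 * p / (κ * lam) * (r₀ / r * D₀ + D₁) := by
  have hpR : (0 : ℝ) < p := by exact_mod_cast hp
  have hrR : (0 : ℝ) < r := by exact_mod_cast hr
  have hnR : (0 : ℝ) < n := by exact_mod_cast hn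
  have hκ := hF.κ_pos
  set v := γ - β with hv
  set sc : Fin n → ℝ := fun i => ((d i).2 - deriv F.ψ (inner ℝ β (d i).1)) * inner ℝ v (d i).1
    with hsc
  set q : Fin n → ℝ := fun i => inner ℝ v (d i).1 * inner ℝ v (d i).1 with hq
  set l : Fin n → ℝ := fun i => logTerm F (d i) γ - logTerm F (d i) β with hl
  -- Optimality of `γ` against `β`, rescaled by `(r + r₀) / (n * r)`: relative to the second step,
  -- the pilot mean has weight `r₀ / r`.
  have hopt : 0 ≤ (r₀ : ℝ) / r * weightedMean π₀ s l + weightedMean π₁ t l := by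
    have h := hγ.2 hβ.1
    change twoStepLogLik F π₀ π₁ d s t β ≤ twoStepLogLik F π₀ π₁ d s t γ at h
    unfold twoStepLogLik at h
    have h' := le_of_mul_le_mul_left h (by positivity)
    have e0 : (r₀ : ℝ) / r * weightedMean π₀ s l =
        ((n : ℝ) * r)⁻¹ * ∑ k, (π₀ (s k))⁻¹ * l (s k) := by
      rcases Nat.eq_zero_or_pos r₀ with h0 | h0
      · subst h0; simp
      have : (0 : ℝ) < r₀ := by exact_mod_cast h0
      simp only [weightedMean, Finset.mul_sum, mul_inv]
      exact Finset.sum_congr rfl fun _ _ => by field_simp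
    have e1 : weightedMean π₁ t l = ((n : ℝ) * r)⁻¹ * ∑ k, (π₁ (t k))⁻¹ * l (t k) := by
      simp only [weightedMean, Finset.mul_sum, mul_inv]
      exact Finset.sum_congr rfl fun _ _ => by ring
    rw [e0, e1, ← mul_add]
    refine mul_nonneg (by positivity) ?_
    simp only [hl, mul_sub, Finset.sum_sub_distrib]
    linarith
  have hb : ∀ i, l i ≤ sc i - κ / 2 * q i := fun i => hF.logTerm_sub_le hβ.1 hγ.1 (hd.norm_le i)
  -- The pilot curvature has a favourable sign and is dropped; the second step alone supplies the
  -- quadratic term.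
  have hw0 : weightedMean π₀ s l ≤ weightedMean π₀ s sc :=
    weightedMean_mono s h₀ fun i => (hb i).trans
      (sub_le_self _ (mul_nonneg (by positivity) (mul_self_nonneg _)))
  have hw1 : weightedMean π₁ t l ≤ weightedMean π₁ t sc - κ / 2 * weightedMean π₁ t q := by
    rw [← weightedMean_const_mul, ← weightedMean_sub]
    exact weightedMean_mono t h₁ hb
  have hpop : popMean sc ≤ 0 := hF.popMean_score_le_zero hd.norm_le hβ hγ.1
  have hscs : sc = fun i => ∑ j, v j * score F d β j i :=
    funext fun i => score_inner_eq_sum F d β v i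
  have hj : Fin p := ⟨0, hp⟩
  have hD0 : 0 ≤ D₀ := (abs_nonneg _).trans (hs hj)
  have hD1 : 0 ≤ D₁ := (abs_nonneg _).trans (ht hj)
  have b0 : weightedMean π₀ s sc - popMean sc ≤ p * ‖v‖ * D₀ := by
    have h := abs_weightedMean_sub_popMean_le (π := π₀) s Finset.univ (fun j => v j)
      (score F d β) (fun j _ => hs j)
    rw [← hscs] at h
    exact (le_abs_self _).trans (h.trans (mul_le_mul_of_nonneg_right (sum_abs_apply_le v) hD0))
  have b1 : weightedMean π₁ t sc - popMean sc ≤ p * ‖v‖ * D₁ := by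
    have h := abs_weightedMean_sub_popMean_le (π := π₁) t Finset.univ (fun j => v j)
      (score F d β) (fun j _ => ht j)
    rw [← hscs] at h
    exact (le_abs_self _).trans (h.trans (mul_le_mul_of_nonneg_right (sum_abs_apply_le v) hD1))
  have hquad := le_weightedMean_quad hp hd htq v
  have hρ : (0 : ℝ) ≤ (r₀ : ℝ) / r := by positivity
  have hmain : κ * lam / 4 * ‖v‖ ^ 2 ≤ p * ‖v‖ * (r₀ / r * D₀ + D₁) := by
    have c0 := mul_le_mul_of_nonneg_left (hw0.trans (by linarith : _ ≤ p * ‖v‖ * D₀)) hρ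
    have c1 := mul_le_mul_of_nonneg_left hquad (by positivity : 0 ≤ κ / 2)
    nlinarith [c0, c1]
  rcases (norm_nonneg v).eq_or_lt with h | h
  · rw [← h]; positivity
  · have : κ * lam / 4 * ‖v‖ ≤ p * (r₀ / r * D₀ + D₁) := by
      refine le_of_mul_le_mul_right ?_ h
      calc _ = κ * lam / 4 * ‖v‖ ^ 2 := by ring
        _ ≤ _ := hmain
        _ = _ := by ring
    rw [div_mul_eq_mul_div, le_div_iff₀ (by positivity)]
    linarith

end RegularDomain

end Deterministic

end GLMSubsampling

/-! ### Two-sided bounds for the second-step weights -/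

namespace GLMSubsampling

variable {p n : ℕ} {F : ExpFamily} {S : Set (EuclideanSpace ℝ (Fin p))} {L κ K A lam δ : ℝ}
  {d : Dataset p n}

lemma pilotInfoMatrix_apply {r₀ : ℕ} (π₀ : Fin n → ℝ) (s : Fin r₀ → Fin n)
    (b : EuclideanSpace ℝ (Fin p)) (j k : Fin p) :
    pilotInfoMatrix F π₀ d s b j k =
      weightedMean π₀ s fun i => deriv (deriv F.ψ) (inner ℝ b (d i).1) * coordProd d (j, k) i := by
  simp only [pilotInfoMatrix, weightedMean, Matrix.smul_apply, Matrix.sum_apply, smul_eq_mul,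
    Matrix.vecMulVec_apply, coordProd, Finset.mul_sum, mul_inv]
  exact Finset.sum_congr rfl fun _ _ => by ring

/-- Writing the bilinear form as a weighted mean turns bounds on `ψ''` and on covariate products
into operator bounds for the pilot matrix. -/
lemma inner_pilotInfoMatrix_mulVec {r₀ : ℕ} (π₀ : Fin n → ℝ) (s : Fin r₀ → Fin n)
    (b v w : EuclideanSpace ℝ (Fin p)) :
    inner ℝ v (WithLp.toLp 2 ((pilotInfoMatrix F π₀ d s b).mulVec w.ofLp)) =
      weightedMean π₀ s fun i => deriv (deriv F.ψ) (inner ℝ b (d i).1) *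
        (inner ℝ v (d i).1 * inner ℝ w (d i).1) := by
  simp only [inner_mul_inner_eq_sum, Finset.mul_sum]
  have : ∀ (q : Fin p × Fin p) (i : Fin n),
      deriv (deriv F.ψ) (inner ℝ b (d i).1) * (v q.1 * w q.2 * coordProd d q i) =
      (v q.1 * w q.2) * (deriv (deriv F.ψ) (inner ℝ b (d i).1) * coordProd d q i) :=
    fun q i => by ring
  simp only [this]
  rw [weightedMean_sum, inner_eq_sum_mul, ← Finset.univ_product_univ, Finset.sum_product]
  refine Finset.sum_congr rfl fun j _ => ?_
  simp only [Matrix.mulVec, dotProduct, pilotInfoMatrix_apply, Finset.mul_sum]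
  exact Finset.sum_congr rfl fun k _ => by ring

lemma weightedMean_norm_sq_le (hn : 0 < n) (hd : ∀ i, ‖(d i).1‖ ≤ L) {r : ℕ}
    {π : Fin n → ℝ} {t : Fin r → Fin n} {τ : ℝ}
    (ht : ∀ q, |weightedMean π t (coordProd d q) - popMean (coordProd d q)| ≤ τ) :
    weightedMean π t (fun i => ‖(d i).1‖ ^ 2) ≤ L ^ 2 + p * τ := by
  have h := abs_weightedMean_sub_popMean_le (π := π) t Finset.univ (fun _ : Fin p => 1)
    (fun a => coordProd d (a, a)) (fun a _ => ht (a, a))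
  simp only [← norm_sq_eq_sum_coordProd, abs_one, Finset.sum_const, Finset.card_univ,
    Fintype.card_fin, nsmul_eq_mul, mul_one] at h
  have h2 : popMean (fun i => ‖(d i).1‖ ^ 2) ≤ L ^ 2 := by
    rw [← popMean_const hn (L ^ 2)]
    exact popMean_mono fun i => pow_le_pow_left₀ (norm_nonneg _) (hd i) 2
  linarith [(abs_le.1 h).2]

/-- The truncated absolute residual `max(|yᵢ - ψ'(bᵀxᵢ)|, δ)`. -/
noncomputable def residual (F : ExpFamily) (δ : ℝ) (d : Dataset p n)
    (b : EuclideanSpace ℝ (Fin p)) (i : Fin n) : ℝ :=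
  max |(d i).2 - deriv F.ψ (inner ℝ b (d i).1)| δ

/-- The second-step weights are comparable to `residual * ‖x‖` when the pilot weighted means of the
covariate products are close to the population means. -/
lemma stepTwoWeight_bounds (hp : 0 < p) (hn : 0 < n) (hF : RegularDomain F S L κ K)
    (hlam : 0 < lam) (hd : GoodData d L A lam) (hδ : 0 < δ) (c : Criterion) {r₀ : ℕ}
    {π₀ : Fin n → ℝ} (h₀ : ∀ i, 0 ≤ π₀ i) {s : Fin r₀ → Fin n}
    (hs : ∀ q, |weightedMean π₀ s (coordProd d q) - popMean (coordProd d q)| ≤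
      lam / (2 * p ^ 2)) {b : EuclideanSpace ℝ (Fin p)} (hb : b ∈ S) (i : Fin n) :
    min 1 (K * (L ^ 2 + p * (lam / (2 * p ^ 2))))⁻¹ * (residual F δ d b i * ‖(d i).1‖) ≤
        stepTwoWeight F c δ π₀ d s b i ∧
      stepTwoWeight F c δ π₀ d s b i ≤
        max 1 (2 / (κ * lam)) * (residual F δ d b i * ‖(d i).1‖) := by
  have hpR : (0 : ℝ) < p := by exact_mod_cast hp
  have hκ := hF.κ_pos
  have hK := hF.K_pos
  have hL := hF.L_pos
  have hm : 0 ≤ residual F δ d b i := hδ.le.trans (le_max_right _ _)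
  have hmx : 0 ≤ residual F δ d b i * ‖(d i).1‖ := by positivity
  -- For mVc the weight equals `residual * ‖x‖`, which is the reason for the `1` in both constants.
  -- For mV the matrix must be bounded above and below.
  cases c with
  | mVc =>
    have e : stepTwoWeight F .mVc δ π₀ d s b i = residual F δ d b i * ‖(d i).1‖ := rfl
    rw [e]
    exact ⟨mul_le_of_le_one_left hmx (min_le_left _ _),
      le_mul_of_one_le_left hmx (le_max_left _ _)⟩
  | mV =>
    set J := pilotInfoMatrix F π₀ d s b with hJ
    set K' := K * (L ^ 2 + p * (lam / (2 * p ^ 2))) with hK'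
    have hK'pos : 0 < K' := by positivity
    have e : stepTwoWeight F .mV δ π₀ d s b i =
      residual F δ d b i * ‖WithLp.toLp 2 (J⁻¹.mulVec (d i).1.ofLp)‖ := rfl
    have hlow : ∀ v : EuclideanSpace ℝ (Fin p),
        κ * lam / 2 * ‖v‖ ^ 2 ≤ inner ℝ v (WithLp.toLp 2 (J.mulVec v.ofLp)) := by
      intro v
      rw [hJ, inner_pilotInfoMatrix_mulVec]
      have h1 := le_weightedMean_quad hp hd hs v
      have h2 : κ * weightedMean π₀ s (fun i => inner ℝ v (d i).1 * inner ℝ v (d i).1) ≤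
          weightedMean π₀ s fun i => deriv (deriv F.ψ) (inner ℝ b (d i).1) *
            (inner ℝ v (d i).1 * inner ℝ v (d i).1) := by
        rw [← weightedMean_const_mul]
        exact weightedMean_mono s h₀ fun i => mul_le_mul_of_nonneg_right
          (hF.le_deriv_deriv b hb _ (hd.norm_le i)) (mul_self_nonneg _)
      nlinarith [mul_le_mul_of_nonneg_left h1 hκ.le]
    -- The form is tested against `w = J v` itself, which bounds `‖w‖ ^ 2` by a multiple of `‖w‖`.
    have hup : ∀ v : EuclideanSpace ℝ (Fin p),
        ‖WithLp.toLp 2 (J.mulVec v.ofLp)‖ ≤ K' * ‖v‖ := by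
      intro v
      set w : EuclideanSpace ℝ (Fin p) := WithLp.toLp 2 (J.mulVec v.ofLp) with hw
      have h1 : ‖w‖ ^ 2 ≤ K' * ‖v‖ * ‖w‖ := by
        rw [← real_inner_self_eq_norm_sq]
        nth_rewrite 2 [hw]
        rw [hJ, inner_pilotInfoMatrix_mulVec]
        have h2 : weightedMean π₀ s (fun i => deriv (deriv F.ψ) (inner ℝ b (d i).1) *
            (inner ℝ w (d i).1 * inner ℝ v (d i).1)) ≤
            weightedMean π₀ s fun i => (K * (‖w‖ * ‖v‖)) * ‖(d i).1‖ ^ 2 := by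
          refine weightedMean_mono s h₀ fun i => ?_
          have k1 := hF.deriv_deriv_le b hb _ (hd.norm_le i)
          have k2 := hF.κ_pos.le.trans (hF.le_deriv_deriv b hb _ (hd.norm_le i))
          have k3 : inner ℝ w (d i).1 * inner ℝ v (d i).1 ≤
              (‖w‖ * ‖(d i).1‖) * (‖v‖ * ‖(d i).1‖) := by
            refine (le_abs_self _).trans ?_
            rw [abs_mul]
            exact mul_le_mul (abs_real_inner_le_norm _ _) (abs_real_inner_le_norm _ _)
              (abs_nonneg _) (by positivity)
          calc _ ≤ deriv (deriv F.ψ) (inner ℝ b (d i).1) *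
                ((‖w‖ * ‖(d i).1‖) * (‖v‖ * ‖(d i).1‖)) := mul_le_mul_of_nonneg_left k3 k2
            _ ≤ K * ((‖w‖ * ‖(d i).1‖) * (‖v‖ * ‖(d i).1‖)) :=
              mul_le_mul_of_nonneg_right k1 (by positivity)
            _ = _ := by ring
        refine h2.trans ?_
        rw [weightedMean_const_mul]
        calc _ ≤ K * (‖w‖ * ‖v‖) * (L ^ 2 + p * (lam / (2 * p ^ 2))) :=
              mul_le_mul_of_nonneg_left (weightedMean_norm_sq_le hn hd.norm_le hs)
                (by positivity)
          _ = _ := by rw [hK']; ring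
      rcases (norm_nonneg w).eq_or_lt with h | h
      · rw [← h]; positivity
      · exact le_of_mul_le_mul_right (by linarith [h1, sq ‖w‖]) h
    have hunit : IsUnit J := by
      rw [← Matrix.mulVec_injective_iff_isUnit]
      intro v₁ v₂ h
      have h1 := hlow (WithLp.toLp 2 (v₁ - v₂))
      have h2 : J.mulVec (v₁ - v₂) = 0 := by rw [Matrix.mulVec_sub, sub_eq_zero]; exact h
      simp only [h2, WithLp.toLp_zero, inner_zero_right] at h1
      have h3 : ‖WithLp.toLp 2 (v₁ - v₂)‖ ^ 2 ≤ 0 :=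
        le_of_mul_le_mul_left (by simpa using h1) (by positivity : 0 < κ * lam / 2)
      have h4 : WithLp.toLp 2 (v₁ - v₂) = 0 := by
        rw [← norm_eq_zero]
        exact pow_eq_zero_iff (two_ne_zero) |>.1 (le_antisymm h3 (by positivity))
      exact sub_eq_zero.1 ((WithLp.toLp_eq_zero 2).1 h4)
    set u : EuclideanSpace ℝ (Fin p) := WithLp.toLp 2 (J⁻¹.mulVec (d i).1.ofLp) with hu
    -- With `x = J u`, the upper bound for `J` bounds `‖u‖` from below, and coercivity bounds it
    -- from above.
    have hJu : WithLp.toLp 2 (J.mulVec u.ofLp) = (d i).1 := by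
      rw [hu]
      simp only [Matrix.mulVec_mulVec]
      rw [Matrix.mul_nonsing_inv _ ((Matrix.isUnit_iff_isUnit_det _).1 hunit), Matrix.one_mulVec]
    have hl : K'⁻¹ * ‖(d i).1‖ ≤ ‖u‖ := by
      have := hup u
      rw [hJu] at this
      rwa [inv_mul_le_iff₀ hK'pos]
    have hr : ‖u‖ ≤ 2 / (κ * lam) * ‖(d i).1‖ := by
      have h1 := hlow u
      rw [hJu] at h1
      have h2 := h1.trans ((le_abs_self _).trans (abs_real_inner_le_norm _ _))
      rcases (norm_nonneg u).eq_or_lt with h | h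
      · rw [← h]; positivity
      · have h3 : κ * lam / 2 * ‖u‖ ≤ ‖(d i).1‖ :=
          le_of_mul_le_mul_right (by linarith [h2, sq ‖u‖]) h
        rw [div_mul_eq_mul_div, le_div_iff₀ (by positivity)]
        linarith
    rw [e]
    constructor
    · calc _ ≤ K'⁻¹ * (residual F δ d b i * ‖(d i).1‖) :=
            mul_le_mul_of_nonneg_right (min_le_right _ _) hmx
        _ = residual F δ d b i * (K'⁻¹ * ‖(d i).1‖) := by ring
        _ ≤ _ := mul_le_mul_of_nonneg_left hl hm
    · calc _ ≤ residual F δ d b i * (2 / (κ * lam) * ‖(d i).1‖) := mul_le_mul_of_nonneg_left hr hm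
        _ = 2 / (κ * lam) * (residual F δ d b i * ‖(d i).1‖) := by ring
        _ ≤ _ := mul_le_mul_of_nonneg_right (le_max_right _ _) hmx

end GLMSubsampling

/-! ### Deviation bounds for the pilot and second-step draws -/

namespace GLMSubsampling

section Draws

variable {n : ℕ}

/-- Chebyshev's inequality for draws from probabilities proportional to `w`. -/
lemma drawLaw_normalized_weightedMean_le {w f G : Fin n → ℝ} (hw : ∀ i, 0 ≤ w i)
    (hW : ∑ i, w i ≠ 0) (hG : ∀ i, 0 ≤ G i) (hf : ∀ i, f i ^ 2 ≤ w i * G i) {V₁ V₂ : ℝ}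
    (h₁ : popMean w ≤ V₁) (h₂ : popMean G ≤ V₂) {r : ℕ} (hr : 0 < r) {D : ℝ} (hD : 0 < D) :
    drawLaw (fun i => w i / ∑ j, w j) r
        {t | D ≤ |weightedMean (fun i => w i / ∑ j, w j) t f - popMean f|} ≤
      ENNReal.ofReal (V₁ * V₂ / (r * D ^ 2)) := by
  have hWpos : 0 < ∑ i, w i := lt_of_le_of_ne (Finset.sum_nonneg fun i _ => hw i) hW.symm
  have hf0 : ∀ i, w i = 0 → f i = 0 := fun i hi => by
    have := hf i
    rw [hi, zero_mul] at this
    exact pow_eq_zero_iff (two_ne_zero) |>.1 (le_antisymm this (by positivity))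
  refine drawLaw_weightedMean_le (fun i => div_nonneg (hw i) hWpos.le) ?_ (fun i hi => ?_) hr ?_ hD
  · rw [← Finset.sum_div, div_self hW]
  · exact hf0 i ((div_eq_zero_iff.1 hi).resolve_right hW)
  · have h0 : 0 ≤ popMean G := mul_nonneg (by positivity) (Finset.sum_nonneg fun i _ => hG i)
    have h1 : 0 ≤ popMean w := mul_nonneg (by positivity) hWpos.le
    refine le_trans ?_ (mul_le_mul h₁ h₂ h0 (h1.trans h₁))
    -- One factor of `f i ^ 2` cancels the weight in the denominator, so the second moment factors
    -- into the population means of `w` and `G`.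
    have : ∀ i, (w i / ∑ j, w j)⁻¹ * f i ^ 2 ≤ (∑ j, w j) * G i := by
      intro i
      rcases (hw i).eq_or_lt with h | h
      · simp only [← h, zero_div, inv_zero, zero_mul]
        exact mul_nonneg hWpos.le (hG i)
      · rw [inv_div, div_mul_eq_mul_div, div_le_iff₀ h, mul_assoc, mul_comm (G i)]
        exact mul_le_mul_of_nonneg_left (hf i) hWpos.le
    calc _ ≤ (n : ℝ)⁻¹ ^ 2 * ∑ i, (∑ j, w j) * G i :=
          mul_le_mul_of_nonneg_left (Finset.sum_le_sum fun i _ => this i) (by positivity)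
      _ = popMean w * popMean G := by rw [← Finset.mul_sum]; unfold popMean; ring

/-- Chebyshev's inequality for draws from probabilities bounded below by a multiple of `1 / n`. -/
lemma drawLaw_weightedMean_le_of_lower_bound (hn : 0 < n) {π f : Fin n → ℝ}
    (h0 : ∀ i, 0 ≤ π i) (h1 : ∑ i, π i = 1) {C : ℝ} (hC : ∀ i, 1 ≤ C * (n * π i)) {V : ℝ}
    (hV : popMean (fun i => f i ^ 2) ≤ V) (hC0 : 0 < C) {r : ℕ} (hr : 0 < r) {D : ℝ}
    (hD : 0 < D) :
    drawLaw π r {t | D ≤ |weightedMean π t f - popMean f|} ≤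
      ENNReal.ofReal (C * V / (r * D ^ 2)) := by
  have hnR : (0 : ℝ) < n := by exact_mod_cast hn
  have hpos : ∀ i, 0 < π i := fun i => lt_of_le_of_ne (h0 i) fun h => by
    have := hC i
    rw [← h] at this
    norm_num at this
  refine drawLaw_weightedMean_le h0 h1 (fun i hi => absurd hi (hpos i).ne') hr ?_ hD
  calc _ ≤ (n : ℝ)⁻¹ ^ 2 * ∑ i, (C * n) * f i ^ 2 := by
        refine mul_le_mul_of_nonneg_left (Finset.sum_le_sum fun i _ => ?_) (by positivity)
        refine mul_le_mul_of_nonneg_right ?_ (by positivity)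
        rw [inv_le_iff_one_le_mul₀ (hpos i)]
        linarith [hC i]
    _ = C * popMean (fun i => f i ^ 2) := by
        rw [← Finset.mul_sum]; unfold popMean; field_simp
    _ ≤ C * V := mul_le_mul_of_nonneg_left hV hC0.le

lemma measure_exists_le {α ι : Type*} [MeasurableSpace α] [Fintype ι] (μ : Measure α)
    (A : ι → Set α) {x : ℝ} (h : ∀ i, μ (A i) ≤ ENNReal.ofReal x) :
    μ {a | ∃ i, a ∈ A i} ≤ ENNReal.ofReal (Fintype.card ι * x) := by
  have e : {a | ∃ i, a ∈ A i} = ⋃ i, A i := by ext; simp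
  rw [e]
  refine (measure_iUnion_fintype_le μ A).trans ((Finset.sum_le_sum fun i _ => h i).trans ?_)
  rw [Finset.sum_const, Finset.card_univ, nsmul_eq_mul,
    ENNReal.ofReal_mul (Nat.cast_nonneg _), ENNReal.ofReal_natCast]

end Draws

variable {p n : ℕ} {F : ExpFamily} {S : Set (EuclideanSpace ℝ (Fin p))} {L κ K A lam δ : ℝ}
  {d : Dataset p n}

lemma popMean_abs_le (hn : 0 < n) (hd : GoodData d L A lam) :
    popMean (fun i => |(d i).2|) ≤ 1 + A := by
  have : popMean (fun i => |(d i).2|) ≤ popMean fun i => (1 : ℝ) + (d i).2 ^ 2 :=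
    popMean_mono fun i => by nlinarith [sq_nonneg (|(d i).2| - 1), sq_abs (d i).2, sq_nonneg (d i).2]
  rw [popMean_add, popMean_const hn] at this
  linarith [hd.sq_le]

/-- The factor `‖x‖` is kept rather than replaced by `L`, since the weights dividing the score may
be as small as a multiple of `‖x‖`. -/
lemma abs_score_le (hF : RegularDomain F S L κ K) (hd : ∀ i, ‖(d i).1‖ ≤ L)
    {β : EuclideanSpace ℝ (Fin p)} (hβ : β ∈ S) (j : Fin p) (i : Fin n) :
    |score F d β j i| ≤ (|(d i).2| + K) * ‖(d i).1‖ := by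
  rw [score, abs_mul]
  refine mul_le_mul ((abs_sub _ _).trans ?_) (abs_apply_le_norm _ _) (abs_nonneg _)
    (add_nonneg (abs_nonneg _) hF.K_pos.le)
  linarith [hF.abs_deriv_le β hβ _ (hd i)]

lemma popMean_score_sq_le (hn : 0 < n) (hF : RegularDomain F S L κ K) (hd : GoodData d L A lam)
    {β : EuclideanSpace ℝ (Fin p)} (hβ : β ∈ S) (j : Fin p) :
    popMean (fun i => score F d β j i ^ 2) ≤ 2 * L ^ 2 * (A + K ^ 2) := by
  have hL := hF.L_pos
  have : popMean (fun i => score F d β j i ^ 2) ≤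
      popMean fun i => 2 * L ^ 2 * ((d i).2 ^ 2 + K ^ 2) := by
    refine popMean_mono fun i => ?_
    have h1 := pow_le_pow_left₀ (abs_nonneg _) (abs_score_le hF hd.norm_le hβ j i) 2
    rw [sq_abs, mul_pow] at h1
    have h2 := pow_le_pow_left₀ (norm_nonneg _) (hd.norm_le i) 2
    have h3 : (|(d i).2| + K) ^ 2 ≤ 2 * ((d i).2 ^ 2 + K ^ 2) := by
      nlinarith [sq_nonneg (|(d i).2| - K), sq_abs (d i).2]
    calc _ ≤ _ := h1
      _ ≤ 2 * ((d i).2 ^ 2 + K ^ 2) * L ^ 2 := mul_le_mul h3 h2 (by positivity) (by positivity)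
      _ = _ := by ring
  refine this.trans ?_
  rw [popMean_const_mul, popMean_add, popMean_const hn]
  exact mul_le_mul_of_nonneg_left (by linarith [hd.sq_le]) (by positivity)

lemma popMean_coordProd_sq_le (hn : 0 < n) (hd : GoodData d L A lam) (q : Fin p × Fin p) :
    popMean (fun i => coordProd d q i ^ 2) ≤ L ^ 4 := by
  rw [← popMean_const hn (L ^ 4)]
  refine popMean_mono fun i => ?_
  have h1 := pow_le_pow_left₀ (abs_nonneg _) (abs_coordProd_le d q i) 2
  rw [sq_abs, ← pow_mul] at h1
  exact h1.trans (pow_le_pow_left₀ (norm_nonneg _) (hd.norm_le i) 4)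

/-- Deviation bounds for the second-step weighted means of scores and of covariate products, for
weights comparable to `residual * ‖x‖`. -/
lemma drawLaw_stepTwo_le (hn : 0 < n) (hF : RegularDomain F S L κ K) (hd : GoodData d L A lam)
    (hδ : 0 < δ) {c₁ c₂ : ℝ} (hc₁ : 0 < c₁) (hc₂ : 0 < c₂) {w : Fin n → ℝ}
    {b β : EuclideanSpace ℝ (Fin p)} (hb : b ∈ S) (hβ : β ∈ S)
    (hw : ∀ i, c₁ * (residual F δ d b i * ‖(d i).1‖) ≤ w i ∧
      w i ≤ c₂ * (residual F δ d b i * ‖(d i).1‖))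
    (hW : ∑ i, w i ≠ 0) {r : ℕ} (hr : 0 < r) {D : ℝ} (hD : 0 < D) :
    (∀ j, drawLaw (fun i => w i / ∑ j, w j) r {t | D ≤
        |weightedMean (fun i => w i / ∑ j, w j) t (score F d β j) - popMean (score F d β j)|} ≤
      ENNReal.ofReal (c₂ * L * (1 + A + K + δ) *
        ((1 + A + K) * (L * (1 + 2 * K / δ) / c₁)) / (r * D ^ 2))) ∧
    (∀ q, drawLaw (fun i => w i / ∑ j, w j) r {t | D ≤
        |weightedMean (fun i => w i / ∑ j, w j) t (coordProd d q) - popMean (coordProd d q)|} ≤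
      ENNReal.ofReal (c₂ * L * (1 + A + K + δ) * (L ^ 3 / (c₁ * δ)) / (r * D ^ 2))) := by
  have hL := hF.L_pos
  have hK := hF.K_pos
  have hm : ∀ i, 0 < residual F δ d b i := fun i => hδ.trans_le (le_max_right _ _)
  have hw0 : ∀ i, 0 ≤ w i := fun i =>
    le_trans (by have := hm i; positivity) (hw i).1
  have hmean : popMean w ≤ c₂ * L * (1 + A + K + δ) := by
    have h1 : popMean w ≤ popMean fun i => c₂ * L * (|(d i).2| + (K + δ)) := by
      refine popMean_mono fun i => (hw i).2.trans ?_
      have h2 : residual F δ d b i ≤ |(d i).2| + (K + δ) := by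
        refine max_le ((abs_sub _ _).trans ?_) (by linarith [abs_nonneg (d i).2])
        linarith [hF.abs_deriv_le b hb _ (hd.norm_le i)]
      calc _ ≤ c₂ * ((|(d i).2| + (K + δ)) * L) := by
            refine mul_le_mul_of_nonneg_left ?_ hc₂.le
            exact mul_le_mul h2 (hd.norm_le i) (norm_nonneg _) (by positivity)
        _ = _ := by ring
    rw [popMean_const_mul, popMean_add, popMean_const hn] at h1
    refine h1.trans (mul_le_mul_of_nonneg_left ?_ (by positivity))
    linarith [popMean_abs_le hn hd]
  refine ⟨fun j => ?_, fun q => ?_⟩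
  -- Only one of the two factors `(|y| + K) * ‖x‖` is absorbed by the weight; what remains is linear
  -- in `|y|`, so the second-moment bound on the responses is enough.
  · refine drawLaw_normalized_weightedMean_le hw0 hW
      (G := fun i => (|(d i).2| + K) * (L * (1 + 2 * K / δ) / c₁))
      (fun i => by positivity) (fun i => ?_) hmean ?_ hr hD
    · have h1 := pow_le_pow_left₀ (abs_nonneg _) (abs_score_le hF hd.norm_le hβ j i) 2
      rw [sq_abs, mul_pow] at h1
      -- Changing the parameter costs at most `2 * K`, and the truncation level `δ` pays for it
      -- however far `b` is from the MLE.
      have h2 : |(d i).2| + K ≤ (1 + 2 * K / δ) * residual F δ d b i := by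
        have h3 := hF.abs_deriv_le b hb _ (hd.norm_le i)
        have h4 : |(d i).2 - deriv F.ψ (inner ℝ b (d i).1)| ≤ residual F δ d b i :=
          le_max_left _ _
        have h5 : δ ≤ residual F δ d b i := le_max_right _ _
        have h6 : 2 * K ≤ 2 * K / δ * residual F δ d b i := by
          rw [div_mul_eq_mul_div, le_div_iff₀ hδ]
          exact mul_le_mul_of_nonneg_left h5 (by positivity)
        have h7 := abs_sub_abs_le_abs_sub (d i).2 (deriv F.ψ (inner ℝ b (d i).1))
        linarith
      have h3 : c₁⁻¹ * (c₁ * (residual F δ d b i * ‖(d i).1‖)) ≤ c₁⁻¹ * w i :=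
        mul_le_mul_of_nonneg_left (hw i).1 (by positivity)
      rw [inv_mul_cancel_left₀ hc₁.ne'] at h3
      have hx := hd.norm_le i
      calc score F d β j i ^ 2 ≤ (|(d i).2| + K) ^ 2 * ‖(d i).1‖ ^ 2 := h1
        _ = (|(d i).2| + K) * ‖(d i).1‖ * ((|(d i).2| + K) * ‖(d i).1‖) := by ring
        _ ≤ (|(d i).2| + K) * L * ((1 + 2 * K / δ) * residual F δ d b i * ‖(d i).1‖) := by
            gcongr
        _ = (|(d i).2| + K) * L * (1 + 2 * K / δ) * (residual F δ d b i * ‖(d i).1‖) := by ring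
        _ ≤ (|(d i).2| + K) * L * (1 + 2 * K / δ) * (c₁⁻¹ * w i) := by gcongr
        _ = _ := by ring
    · have : (fun i => (|(d i).2| + K) * (L * (1 + 2 * K / δ) / c₁)) =
          fun i => (L * (1 + 2 * K / δ) / c₁) * (|(d i).2| + K) := by ext; ring
      rw [this, popMean_const_mul, popMean_add, popMean_const hn, mul_comm]
      refine mul_le_mul_of_nonneg_right ?_ (by positivity)
      linarith [popMean_abs_le hn hd]
  · refine drawLaw_normalized_weightedMean_le hw0 hW (G := fun _ => L ^ 3 / (c₁ * δ))
      (fun i => by positivity) (fun i => ?_) hmean (popMean_const hn _).le hr hD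
    have h1 := pow_le_pow_left₀ (abs_nonneg _) (abs_coordProd_le d q i) 2
    rw [sq_abs] at h1
    have h2 : c₁ * (δ * ‖(d i).1‖) ≤ w i := le_trans
      (mul_le_mul_of_nonneg_left (mul_le_mul_of_nonneg_right (le_max_right _ _) (norm_nonneg _))
        hc₁.le) (hw i).1
    have hx := hd.norm_le i
    calc coordProd d q i ^ 2 ≤ (‖(d i).1‖ ^ 2) ^ 2 := h1
      _ = ‖(d i).1‖ * ‖(d i).1‖ ^ 3 := by ring
      _ ≤ ‖(d i).1‖ * L ^ 3 := by gcongr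
      _ = (c₁ * (δ * ‖(d i).1‖)) * (L ^ 3 / (c₁ * δ)) := by field_simp
      _ ≤ _ := by gcongr

end GLMSubsampling

/-! ### The conditional error probability for good data -/

namespace GLMSubsampling

variable {p n : ℕ} {F : ExpFamily} {S : Set (EuclideanSpace ℝ (Fin p))} {L κ K A lam δ : ℝ}
  {d : Dataset p n}

lemma measure_exists_union_le {α ι ι' : Type*} [MeasurableSpace α] [Fintype ι] [Fintype ι']
    (μ : Measure α) (A : ι → Set α) (B : ι' → Set α) {x y u v : ℝ}
    (hA : ∀ i, μ (A i) ≤ ENNReal.ofReal x) (hB : ∀ i, μ (B i) ≤ ENNReal.ofReal y)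
    (hu : Fintype.card ι * x ≤ u) (hv : Fintype.card ι' * y ≤ v) (hu0 : 0 ≤ u) (hv0 : 0 ≤ v) :
    μ ({a | ∃ i, a ∈ A i} ∪ {a | ∃ i, a ∈ B i}) ≤ ENNReal.ofReal (u + v) := by
  rw [ENNReal.ofReal_add hu0 hv0]
  exact (measure_union_le _ _).trans (add_le_add
    ((measure_exists_le μ A hA).trans (ENNReal.ofReal_le_ofReal hu))
    ((measure_exists_le μ B hB).trans (ENNReal.ofReal_le_ofReal hv)))

/-- Residuals are at least `δ`, so vanishing weights would force all covariates to vanish, against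
the coercive design. On good pilot draws the algorithm therefore cannot fail. -/
lemma GoodData.sum_ne_zero (hp : 0 < p) (hd : GoodData d L A lam) (hlam : 0 < lam) (hδ : 0 < δ)
    {c₁ : ℝ} (hc₁ : 0 < c₁) {b : EuclideanSpace ℝ (Fin p)} {w : Fin n → ℝ}
    (hw : ∀ i, c₁ * (residual F δ d b i * ‖(d i).1‖) ≤ w i) : ∑ i, w i ≠ 0 := by
  have hm : ∀ i, 0 < residual F δ d b i := fun i => hδ.trans_le (le_max_right _ _)
  intro h
  have h0 : ∀ i, 0 ≤ w i := fun i => le_trans (by have := hm i; positivity) (hw i)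
  rw [Finset.sum_eq_zero_iff_of_nonneg fun i _ => h0 i] at h
  have hx : ∀ i, (d i).1 = 0 := by
    intro i
    have h1 := hw i
    rw [h i (Finset.mem_univ i)] at h1
    rw [← norm_le_zero_iff]
    refine le_of_mul_le_mul_left ?_ (mul_pos hc₁ (hm i))
    linarith
  have h1 := hd.le_quad (EuclideanSpace.single ⟨0, hp⟩ 1)
  simp [hx, popMean] at h1
  linarith

/-- The error probability is at most the probability of an exceptional set of pilot draws plus a
bound, valid off that set, for the error probability given the pilot draws. -/
lemma errorProb_le (hδ : 0 < δ) {c : Criterion} {π₀ : Fin n → ℝ} (h0 : ∀ i, 0 ≤ π₀ i)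
    (h1 : ∑ i, π₀ i = 1) {r₀ r : ℕ} {pilot : (Fin r₀ → Fin n) → EuclideanSpace ℝ (Fin p)}
    {est : (Fin r₀ → Fin n) → (Fin r → Fin n) → EuclideanSpace ℝ (Fin p)}
    {β : EuclideanSpace ℝ (Fin p)} {ρ : ℝ} {bad : Set (Fin r₀ → Fin n)} {x y : ℝ≥0∞}
    (hbad : drawLaw π₀ r₀ bad ≤ x)
    (hgood : ∀ s, s ∉ bad →
      (if ∑ j, stepTwoWeight F c δ π₀ d s (pilot s) j = 0 then 1
        else drawLaw (stepTwoProb F c δ π₀ d s (pilot s)) r {t | ρ ≤ ‖est s t - β‖}) ≤ y) :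
    errorProb F c δ π₀ d r₀ r pilot est β ρ ≤ x + y := by
  have hP := isProbabilityMeasure_drawLaw h0 h1 r₀
  unfold errorProb
  calc _ ≤ ∫⁻ s, (bad.indicator 1 s + y) ∂(drawLaw π₀ r₀) := by
        refine lintegral_mono fun s => ?_
        by_cases hs : s ∈ bad
        · rw [Set.indicator_of_mem hs]
          refine le_trans ?_ le_self_add
          split_ifs with hW
          · exact le_rfl
          · have hwn : ∀ i, 0 ≤ stepTwoWeight F c δ π₀ d s (pilot s) i := by
              intro i
              refine mul_nonneg (hδ.le.trans (le_max_right _ _)) ?_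
              cases c <;> exact norm_nonneg _
            have := isProbabilityMeasure_drawLaw
              (π := stepTwoProb F c δ π₀ d s (pilot s))
              (fun i => div_nonneg (hwn i) (Finset.sum_nonneg fun i _ => hwn i))
              (by simp only [stepTwoProb]; rw [← Finset.sum_div, div_self hW]) r
            exact prob_le_one
        · rw [Set.indicator_of_notMem hs, zero_add]
          exact hgood s hs
    _ = drawLaw π₀ r₀ bad + y := by
        rw [lintegral_add_right _ measurable_const, lintegral_const, measure_univ, mul_one,
          lintegral_indicator_one (MeasurableSet.of_discrete)]
    _ ≤ x + y := by gcongr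

/-- Union bound over the `p * p` covariate products: it is used with `k = 8` for the pilot and `k =
4` for the second step. -/
lemma sq_mul_div_le_of_lt {V τ ε M R k : ℝ} (hτ : 0 < τ) (hε : 0 < ε) (hR : 0 < R)
    (hk : 0 < k) (hM : k * p ^ 2 * V / (τ ^ 2 * ε) < M) (hMR : M ≤ R) :
    (p : ℝ) * p * (V / (R * τ ^ 2)) ≤ ε / k := by
  rw [div_lt_iff₀ (by positivity)] at hM
  rw [← mul_div_assoc, div_le_iff₀ (by positivity), div_mul_eq_mul_div, le_div_iff₀ hk]
  have := mul_le_mul_of_nonneg_right hMR (by positivity : 0 ≤ τ ^ 2 * ε)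
  linarith

/-- The conditional error probability of the two-step estimator is below `ε` for good data, with a
radius `Δ` that does not depend on the lower bound `1 / C` for `n π₀ᵢ`. -/
theorem exists_errorProb_lt (hp : 0 < p) (hF : RegularDomain F S L κ K) (hlam : 0 < lam)
    (hA : 0 ≤ A) (hδ : 0 < δ) (c : Criterion) {ε : ℝ} (hε : 0 < ε) :
    ∃ Δ : ℝ, 0 < Δ ∧ ∀ C : ℝ, 0 < C → ∃ M : ℕ, ∃ η : ℝ, 0 < η ∧ ∀ (n : ℕ) (_ : 0 < n)
      (d : Dataset p n) (_ : GoodData d L A lam) (π₀ : Fin n → ℝ) (_ : ∀ i, 0 ≤ π₀ i)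
      (_ : ∑ i, π₀ i = 1) (_ : ∀ i, 1 ≤ C * (n * π₀ i)) (r₀ r : ℕ) (_ : M ≤ r₀) (_ : M ≤ r)
      (_ : (r₀ : ℝ) / r ≤ η) (pilot : (Fin r₀ → Fin n) → EuclideanSpace ℝ (Fin p))
      (_ : ∀ s, pilot s ∈ S)
      (est : (Fin r₀ → Fin n) → (Fin r → Fin n) → EuclideanSpace ℝ (Fin p))
      (_ : ∀ s t, IsMaximizer S
        (twoStepLogLik F π₀ (stepTwoProb F c δ π₀ d s (pilot s)) d s t) (est s t))
      (β : EuclideanSpace ℝ (Fin p)) (_ : IsMaximizer S (logLik F d) β),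
      errorProb F c δ π₀ d r₀ r pilot est β ((r : ℝ) ^ (-(1 / 2) : ℝ) * Δ) <
        ENNReal.ofReal ε := by
  have hpR : (0 : ℝ) < p := by exact_mod_cast hp
  have hκ := hF.κ_pos
  have hK := hF.K_pos
  have hL := hF.L_pos
  set τ : ℝ := lam / (2 * p ^ 2) with hτ
  have hτ0 : 0 < τ := by positivity
  set c₁ : ℝ := min 1 (K * (L ^ 2 + p * τ))⁻¹ with hc₁
  set c₂ : ℝ := max 1 (2 / (κ * lam)) with hc₂
  have hc₁0 : 0 < c₁ := lt_min one_pos (by positivity)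
  have hc₂0 : 0 < c₂ := lt_max_of_lt_left one_pos
  set V₀ : ℝ := 2 * L ^ 2 * (A + K ^ 2) with hV₀
  set V₁ : ℝ := c₂ * L * (1 + A + K + δ) * ((1 + A + K) * (L * (1 + 2 * K / δ) / c₁)) with hV₁
  set V₂ : ℝ := c₂ * L * (1 + A + K + δ) * (L ^ 3 / (c₁ * δ)) with hV₂
  have hV₀0 : 0 < V₀ := by positivity
  have hV₁0 : 0 < V₁ := by positivity
  have hV₂0 : 0 < V₂ := by positivity
  -- Chosen so that the union bound for the `p` second-step scores, `p * V₁ / D ^ 2`, equals `ε /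
  -- 4`.
  set D : ℝ := √(4 * p * V₁ / ε) with hD
  have hD0 : 0 < D := Real.sqrt_pos.2 (by positivity)
  have hD2 : D ^ 2 = 4 * p * V₁ / ε := Real.sq_sqrt (by positivity)
  -- The pilot and the second step contribute `4 * p * D / (κ * lam)` each; the extra `1` makes the
  -- final comparison strict.
  refine ⟨8 * p * D / (κ * lam) + 1, by positivity, fun C hC => ?_⟩
  obtain ⟨M, hM⟩ := exists_nat_gt
    (4 * p ^ 2 * V₂ / (τ ^ 2 * ε) + 8 * p ^ 2 * (C * L ^ 4) / (τ ^ 2 * ε))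
  have hMa : 4 * p ^ 2 * V₂ / (τ ^ 2 * ε) < M := lt_of_le_of_lt
    (le_add_of_nonneg_right (by positivity)) hM
  have hMb : 8 * p ^ 2 * (C * L ^ 4) / (τ ^ 2 * ε) < M := lt_of_le_of_lt
    (le_add_of_nonneg_left (by positivity)) hM
  have hMpos : (0 : ℝ) < M := lt_of_le_of_lt (by positivity) hMa
  -- This ratio makes the pilot score failure probability `p * C * V₀ * (r₀ / r) / D ^ 2` at most `ε
  -- / 8`.
  refine ⟨M, ε * D ^ 2 / (8 * (p * (C * V₀))), by positivity, ?_⟩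
  intro n hn d hd π₀ h0 h1 hπ r₀ r hr₀ hr hratio pilot hpilot est hest β hβ
  have hr₀M : (M : ℝ) ≤ r₀ := by exact_mod_cast hr₀
  have hrM : (M : ℝ) ≤ r := by exact_mod_cast hr
  have hr₀R : (0 : ℝ) < r₀ := hMpos.trans_le hr₀M
  have hrR : (0 : ℝ) < r := hMpos.trans_le hrM
  have hr₀N : 0 < r₀ := by exact_mod_cast hr₀R
  have hrN : 0 < r := by exact_mod_cast hrR
  have hsq : 0 < √(r : ℝ) := Real.sqrt_pos.2 hrR
  have hsq2 : √(r : ℝ) ^ 2 = r := Real.sq_sqrt hrR.le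
  have hρ : (r : ℝ) ^ (-(1 / 2) : ℝ) = (√(r : ℝ))⁻¹ := by
    rw [Real.rpow_neg hrR.le, Real.sqrt_eq_rpow]
  -- The pilot tolerance is calibrated so that `r₀ / r * D₀ = D₁`.
  set D₀ : ℝ := D * √(r : ℝ) / r₀ with hD₀
  set D₁ : ℝ := D / √(r : ℝ) with hD₁
  have hD₀0 : 0 < D₀ := by positivity
  have hD₁0 : 0 < D₁ := by positivity
  set bad : Set (Fin r₀ → Fin n) :=
    {s | ∃ j, s ∈ {s | D₀ ≤ |weightedMean π₀ s (score F d β j) - popMean (score F d β j)|}} ∪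
    {s | ∃ q, s ∈ {s | τ ≤ |weightedMean π₀ s (coordProd d q) - popMean (coordProd d q)|}}
    with hbad
  have hbadm : drawLaw π₀ r₀ bad ≤ ENNReal.ofReal (ε / 8 + ε / 8) := by
    refine measure_exists_union_le _ _ _
      (fun j => drawLaw_weightedMean_le_of_lower_bound hn h0 h1 hπ
        (popMean_score_sq_le hn hF hd hβ.1 j) hC hr₀N hD₀0)
      (fun q => drawLaw_weightedMean_le_of_lower_bound hn h0 h1 hπ
        (popMean_coordProd_sq_le hn hd q) hC hr₀N hτ0) ?_ ?_ (by positivity) (by positivity)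
    · rw [Fintype.card_fin, hD₀, div_pow, mul_pow, hsq2]
      rw [le_div_iff₀ (by positivity)] at hratio
      have e : p * (C * V₀ / (r₀ * (D ^ 2 * r / r₀ ^ 2))) =
          (r₀ / r * (8 * (p * (C * V₀)))) / (8 * D ^ 2) := by field_simp
      rw [e, div_le_iff₀ (by positivity)]
      linarith
    · rw [Fintype.card_prod, Fintype.card_fin, Nat.cast_mul]
      exact sq_mul_div_le_of_lt hτ0 hε hr₀R (by norm_num) hMb hr₀M
  have hgood : ∀ s, s ∉ bad →
      (if ∑ j, stepTwoWeight F c δ π₀ d s (pilot s) j = 0 then 1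
        else drawLaw (stepTwoProb F c δ π₀ d s (pilot s)) r
          {t | (r : ℝ) ^ (-(1 / 2) : ℝ) * (8 * p * D / (κ * lam) + 1) ≤ ‖est s t - β‖}) ≤
        ENNReal.ofReal (ε / 4 + ε / 4) := by
    intro s hs
    have hs1 : ∀ j, |weightedMean π₀ s (score F d β j) - popMean (score F d β j)| ≤ D₀ := by
      intro j
      by_contra hcon
      exact hs (Or.inl ⟨j, (not_le.1 hcon).le⟩)
    have hs2 : ∀ q, |weightedMean π₀ s (coordProd d q) - popMean (coordProd d q)| ≤ τ := by
      intro q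
      by_contra hcon
      exact hs (Or.inr ⟨q, (not_le.1 hcon).le⟩)
    have hw := stepTwoWeight_bounds hp hn hF hlam hd hδ c h0 hs2 (hpilot s)
    have hW := hd.sum_ne_zero hp hlam hδ hc₁0 fun i => (hw i).1
    rw [if_neg hW]
    obtain ⟨hdev1, -⟩ := drawLaw_stepTwo_le hn hF hd hδ hc₁0 hc₂0 (hpilot s) hβ.1 hw hW hrN
      hD₁0
    obtain ⟨-, hdev2⟩ := drawLaw_stepTwo_le hn hF hd hδ hc₁0 hc₂0 (hpilot s) hβ.1 hw hW hrN hτ0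
    have hw0 : ∀ i, 0 ≤ stepTwoWeight F c δ π₀ d s (pilot s) i := fun i => le_trans
      (mul_nonneg hc₁0.le (mul_nonneg (hδ.le.trans (le_max_right _ _)) (norm_nonneg _))) (hw i).1
    refine le_trans (measure_mono ?_) (measure_exists_union_le _ _ _ hdev1 hdev2 ?_ ?_
      (by positivity) (by positivity))
    · intro t ht
      by_contra hcon
      simp only [Set.mem_union, not_or] at hcon
      have ht1 : ∀ j, |weightedMean (stepTwoProb F c δ π₀ d s (pilot s)) t (score F d β j) -
          popMean (score F d β j)| ≤ D₁ := by
        intro j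
        by_contra hc'
        exact hcon.1 ⟨j, (not_le.1 hc').le⟩
      have ht2 : ∀ q, |weightedMean (stepTwoProb F c δ π₀ d s (pilot s)) t (coordProd d q) -
          popMean (coordProd d q)| ≤ τ := by
        intro q
        by_contra hc'
        exact hcon.2 ⟨q, (not_le.1 hc').le⟩
      have key := hF.norm_sub_le hp hlam hd hn hrN h0
        (fun i => div_nonneg (hw0 i) (Finset.sum_nonneg fun i _ => hw0 i)) hβ (hest s t) hs1 ht1 ht2
      have e : 4 * p / (κ * lam) * (r₀ / r * D₀ + D₁) =
          (√(r : ℝ))⁻¹ * (8 * p * D / (κ * lam)) := by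
        rw [hD₀, hD₁]
        nth_rewrite 1 [← hsq2]
        field_simp
        ring
      rw [e] at key
      have ht' : (r : ℝ) ^ (-(1 / 2) : ℝ) * (8 * p * D / (κ * lam) + 1) ≤ ‖est s t - β‖ := ht
      rw [hρ, mul_add, mul_one] at ht'
      have : 0 < (√(r : ℝ))⁻¹ := by positivity
      linarith
    · rw [Fintype.card_fin, ← hV₁, hD₁, div_pow, hsq2, hD2]
      refine le_of_eq ?_
      field_simp
    · rw [Fintype.card_prod, Fintype.card_fin, Nat.cast_mul, ← hV₂]
      exact sq_mul_div_le_of_lt hτ0 hε hrR (by norm_num) hMa hrM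
  have hle : errorProb F c δ π₀ d r₀ r pilot est β
      ((r : ℝ) ^ (-(1 / 2) : ℝ) * (8 * p * D / (κ * lam) + 1)) ≤
      ENNReal.ofReal (ε / 8 + ε / 8) + ENNReal.ofReal (ε / 4 + ε / 4) :=
    errorProb_le hδ h0 h1 hbadm hgood
  refine hle.trans_lt ?_
  rw [← ENNReal.ofReal_add (by positivity) (by positivity)]
  exact (ENNReal.ofReal_lt_ofReal_iff hε).2 (by linarith)

end GLMSubsampling

/-! ### Moment bounds, a weak law, and coercivity -/

namespace GLMSubsampling

/-- Fourth moments are bounded uniformly over natural parameters in a compact interval. -/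
lemma ExpFamily.exists_lintegral_pow_four_le (F : ExpFamily) {a b : ℝ}
    (hab : Set.Icc a b ⊆ interior F.naturalSpace) :
    ∃ m : ℝ, 0 ≤ m ∧ ∀ θ ∈ Set.Icc a b,
      ∫⁻ y, ENNReal.ofReal (y ^ 4) ∂(F.law θ) ≤ ENNReal.ofReal m := by
  rcases lt_or_ge b a with hlt | hle
  · exact ⟨0, le_rfl, fun θ hθ => absurd (hθ.1.trans hθ.2) (not_le.2 hlt)⟩
  obtain ⟨K, hK, hbd⟩ := F.exists_deriv_bounds hab
  obtain ⟨t₁, ht₁, hb₁⟩ := Metric.isOpen_iff.1 isOpen_interior a (hab ⟨le_rfl, hle⟩)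
  obtain ⟨t₂, ht₂, hb₂⟩ := Metric.isOpen_iff.1 isOpen_interior b (hab ⟨hle, le_rfl⟩)
  -- Half the smaller radius keeps `a ± t` and `b ± t` in the interior, leaving exponential room to
  -- absorb `y ^ 4`.
  set t := min t₁ t₂ / 2 with ht
  have ht0 : 0 < t := by positivity
  have htt₁ : t < t₁ := by have := min_le_left t₁ t₂; rw [ht]; linarith
  have htt₂ : t < t₂ := by have := min_le_right t₁ t₂; rw [ht]; linarith
  have i₁ : Integrable (fun y => Real.exp ((a + t) * y)) F.base :=
    F.integrable_exp_of_mem (interior_subset (hb₁ (by simp [abs_of_pos ht0, htt₁])))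
  have i₂ : Integrable (fun y => Real.exp ((a - t) * y)) F.base :=
    F.integrable_exp_of_mem (interior_subset (hb₁ (by simp [abs_of_pos ht0, htt₁])))
  have i₃ : Integrable (fun y => Real.exp ((b + t) * y)) F.base :=
    F.integrable_exp_of_mem (interior_subset (hb₂ (by simp [abs_of_pos ht0, htt₂])))
  have i₄ : Integrable (fun y => Real.exp ((b - t) * y)) F.base :=
    F.integrable_exp_of_mem (interior_subset (hb₂ (by simp [abs_of_pos ht0, htt₂])))
  -- An integrable majorant free of `θ`: `24 / t ^ 4` with `exp (± t y)` dominates `y ^ 4`, the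
  -- endpoint tilts dominate `exp (θ y)`, and `exp K` bounds the normalization.
  set G : ℝ → ℝ := fun y => (Real.exp K * (24 / t ^ 4)) *
    (Real.exp ((a + t) * y) + Real.exp ((a - t) * y) +
      (Real.exp ((b + t) * y) + Real.exp ((b - t) * y))) with hG
  have hGi : Integrable G F.base := ((i₁.add i₂).add (i₃.add i₄)).const_mul _
  have hGm : Measurable G := by fun_prop
  refine ⟨∫ y, G y ∂F.base, integral_nonneg fun y => by positivity, fun θ hθ => ?_⟩
  have hpt : ∀ y, y ^ 4 * Real.exp (θ * y - F.ψ θ) ≤ G y := by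
    intro y
    have h1 : y ^ 4 ≤ 24 / t ^ 4 * (Real.exp (t * y) + Real.exp (-(t * y))) := by
      have h := Real.pow_div_factorial_le_exp |t * y| (abs_nonneg _) 4
      have h' := h.trans (Real.exp_abs_le (t * y))
      have e4 : |t * y| ^ 4 = t ^ 4 * y ^ 4 := by
        rw [← mul_pow, Even.pow_abs (by decide)]
      rw [e4, show ((Nat.factorial 4 : ℕ) : ℝ) = 24 by norm_num [Nat.factorial],
        div_le_iff₀ (by norm_num)] at h'
      rw [div_mul_eq_mul_div, le_div_iff₀ (by positivity)]
      linarith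
    have h2 : Real.exp (θ * y) ≤ Real.exp (a * y) + Real.exp (b * y) := by
      rcases le_total 0 y with hy | hy
      · have : Real.exp (θ * y) ≤ Real.exp (b * y) :=
          Real.exp_le_exp.2 (mul_le_mul_of_nonneg_right hθ.2 hy)
        linarith [Real.exp_pos (a * y)]
      · have : Real.exp (θ * y) ≤ Real.exp (a * y) :=
          Real.exp_le_exp.2 (mul_le_mul_of_nonpos_right hθ.1 hy)
        linarith [Real.exp_pos (b * y)]
    have h3 : Real.exp (-F.ψ θ) ≤ Real.exp K :=
      Real.exp_le_exp.2 (by linarith [neg_abs_le (F.ψ θ), (hbd θ hθ).1])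
    calc y ^ 4 * Real.exp (θ * y - F.ψ θ)
        = y ^ 4 * Real.exp (θ * y) * Real.exp (-F.ψ θ) := by
          rw [sub_eq_add_neg, Real.exp_add]; ring
      _ ≤ 24 / t ^ 4 * (Real.exp (t * y) + Real.exp (-(t * y))) *
          (Real.exp (a * y) + Real.exp (b * y)) * Real.exp K := by gcongr
      _ = G y := by
          simp only [hG, add_mul, neg_mul, Real.exp_add, sub_eq_add_neg]; ring
  have hm1 : Measurable fun y => ENNReal.ofReal (F.h y * Real.exp (θ * y - F.ψ θ)) :=
    (F.measurable_h.mul (by fun_prop)).ennreal_ofReal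
  have hm2 : Measurable fun y => ENNReal.ofReal (F.h y) := F.measurable_h.ennreal_ofReal
  rw [ofReal_integral_eq_lintegral_ofReal hGi (.of_forall fun y => by positivity), law, base,
    lintegral_withDensity_eq_lintegral_mul _ hm1 (by fun_prop),
    lintegral_withDensity_eq_lintegral_mul _ hm2 hGm.ennreal_ofReal]
  refine lintegral_mono fun y => ?_
  simp only [Pi.mul_apply]
  rw [← ENNReal.ofReal_mul (mul_nonneg (F.h_nonneg y) (Real.exp_pos _).le),
    ← ENNReal.ofReal_mul (F.h_nonneg y)]
  refine ENNReal.ofReal_le_ofReal ?_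
  calc _ = F.h y * (y ^ 4 * Real.exp (θ * y - F.ψ θ)) := by ring
    _ ≤ _ := mul_le_mul_of_nonneg_left (hpt y) (F.h_nonneg y)

lemma lintegral_le_of_condDistrib {Ω α : Type*} [MeasurableSpace Ω] [MeasurableSpace α]
    {P : Measure Ω} [IsProbabilityMeasure P] {X : Ω → α} {Y : Ω → ℝ} (hX : Measurable X)
    (hY : Measurable Y) {g : ℝ → ℝ≥0∞} (hg : Measurable g) {m : ℝ≥0∞}
    (h : ∀ᵐ x ∂(P.map X), ∫⁻ y, g y ∂(condDistrib Y X P x) ≤ m) :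
    ∫⁻ ω, g (Y ω) ∂P ≤ m := by
  have hg' : Measurable fun q : α × ℝ => g q.2 := hg.comp measurable_snd
  have hprob : IsProbabilityMeasure (P.map X) := Measure.isProbabilityMeasure_map hX.aemeasurable
  calc ∫⁻ ω, g (Y ω) ∂P = ∫⁻ q, g q.2 ∂(P.map fun ω => (X ω, Y ω)) :=
        (lintegral_map hg' (hX.prodMk hY)).symm
    _ = ∫⁻ x, ∫⁻ y, g y ∂(condDistrib Y X P x) ∂(P.map X) := by
        rw [← compProd_map_condDistrib hY.aemeasurable, Measure.lintegral_compProd hg']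
    _ ≤ ∫⁻ _, m ∂(P.map X) := lintegral_mono_ae h
    _ = m := by simp

/-- Averages of independent variables with uniformly bounded second moments are bounded with
probability tending to one. -/
lemma tendsto_measure_average_gt {Ω : Type*} [MeasurableSpace Ω] {P : Measure Ω}
    [IsProbabilityMeasure P] {Z : ℕ → Ω → ℝ} (hZ : ∀ i, Measurable (Z i)) (hind : iIndepFun Z P)
    {m : ℝ} (hm0 : 0 ≤ m)
    (hm : ∀ i, ∫⁻ ω, ENNReal.ofReal (Z i ω ^ 2) ∂P ≤ ENNReal.ofReal m) :
    Tendsto (fun n : ℕ => P {ω | ¬ (n : ℝ)⁻¹ * ∑ i ∈ Finset.range n, Z i ω ≤ 2 + m}) atTop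
      (𝓝 0) := by
  have hsq : ∀ i, Integrable (fun ω => Z i ω ^ 2) P := fun i =>
    ⟨((hZ i).pow_const 2).aestronglyMeasurable, by
      rw [hasFiniteIntegral_iff_ofReal (.of_forall fun ω => sq_nonneg _)]
      exact (hm i).trans_lt ENNReal.ofReal_lt_top⟩
  have hL2 : ∀ i, MemLp (Z i) 2 P := fun i =>
    (memLp_two_iff_integrable_sq (hZ i).aestronglyMeasurable).2 (hsq i)
  have hint2 : ∀ i, ∫ ω, Z i ω ^ 2 ∂P ≤ m := fun i => by
    rw [integral_eq_lintegral_of_nonneg_ae (.of_forall fun ω => sq_nonneg _)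
      (hsq i).aestronglyMeasurable]
    exact ENNReal.toReal_le_of_le_ofReal hm0 (hm i)
  have hint1 : ∀ i, ∫ ω, Z i ω ∂P ≤ 1 + m := fun i => by
    have hi : Integrable (Z i) P := (hL2 i).integrable (by norm_num)
    have : ∫ ω, Z i ω ∂P ≤ ∫ ω, (1 + Z i ω ^ 2) ∂P :=
      integral_mono hi ((integrable_const 1).add (hsq i))
        fun ω => by nlinarith [sq_nonneg (Z i ω - 1), sq_nonneg (Z i ω)]
    rw [integral_add (integrable_const 1) (hsq i)] at this
    simp at this
    linarith [hint2 i]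
  have hvar : ∀ i, Var[Z i; P] ≤ m := fun i =>
    (variance_le_expectation_sq (hZ i).aestronglyMeasurable).trans (hint2 i)
  -- Means are at most `1 + m`, so exceeding `2 + m` is a deviation of the sum by at least `n`,
  -- against a variance of at most `n * m`.
  have hbound : ∀ n : ℕ, 0 < n →
      P {ω | ¬ (n : ℝ)⁻¹ * ∑ i ∈ Finset.range n, Z i ω ≤ 2 + m} ≤ ENNReal.ofReal (m / n) := by
    intro n hn
    have hnR : (0 : ℝ) < n := by exact_mod_cast hn
    have hW : MemLp (∑ i ∈ Finset.range n, Z i) 2 P := memLp_finsetSum' _ fun i _ => hL2 i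
    have hWv : Var[∑ i ∈ Finset.range n, Z i; P] ≤ n * m := by
      rw [IndepFun.variance_sum (fun i _ => hL2 i)
        (fun i _ j _ hij => hind.indepFun hij)]
      refine (Finset.sum_le_sum fun i _ => hvar i).trans ?_
      simp
    have hWi : ∫ ω, (∑ i ∈ Finset.range n, Z i) ω ∂P ≤ n * (1 + m) := by
      simp only [Finset.sum_apply]
      rw [integral_finsetSum _ fun i _ => (hL2 i).integrable (by norm_num)]
      refine (Finset.sum_le_sum fun i _ => hint1 i).trans (le_of_eq ?_)
      simp; ring
    refine le_trans (measure_mono ?_) ((meas_ge_le_variance_div_sq hW hnR).trans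
      (ENNReal.ofReal_le_ofReal ?_))
    · intro ω hω
      have h1 : 2 + m < (n : ℝ)⁻¹ * ∑ i ∈ Finset.range n, Z i ω := not_le.1 hω
      rw [inv_mul_eq_div, lt_div_iff₀ hnR] at h1
      change (n : ℝ) ≤ |(∑ i ∈ Finset.range n, Z i) ω - ∫ x, (∑ i ∈ Finset.range n, Z i) x ∂P|
      refine le_trans ?_ (le_abs_self _)
      rw [Finset.sum_apply]
      linarith
    · rw [div_le_div_iff₀ (by positivity) hnR]
      nlinarith
  have hlim : Tendsto (fun n : ℕ => ENNReal.ofReal (m / n)) atTop (𝓝 0) := by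
    have := ENNReal.tendsto_ofReal (tendsto_const_div_atTop_nhds_zero_nat m)
    simpa using this
  exact tendsto_of_tendsto_of_tendsto_of_le_of_le' tendsto_const_nhds hlim
    (.of_forall fun _ => zero_le) ((eventually_gt_atTop 0).mono hbound)

/-- A positive definite matrix is coercive. -/
lemma exists_pos_mul_norm_sq_le {p : ℕ} {J : Matrix (Fin p) (Fin p) ℝ} (hJ : J.PosDef) :
    ∃ m : ℝ, 0 < m ∧ ∀ v : EuclideanSpace ℝ (Fin p),
      m * ‖v‖ ^ 2 ≤ ∑ q : Fin p × Fin p, (v q.1 * v q.2) * J q.1 q.2 := by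
  set Q : EuclideanSpace ℝ (Fin p) → ℝ := fun v => ∑ q : Fin p × Fin p, (v q.1 * v q.2) * J q.1 q.2
    with hQ
  have hpos : ∀ v, v ≠ 0 → 0 < Q v := by
    intro v hv
    have h := hJ.dotProduct_mulVec_pos (x := v.ofLp) (by simpa using hv)
    refine h.trans_eq ?_
    simp only [hQ, dotProduct, Matrix.mulVec, ← Finset.univ_product_univ, Finset.sum_product,
      Finset.mul_sum, Pi.star_apply, star_trivial]
    exact Finset.sum_congr rfl fun _ _ => Finset.sum_congr rfl fun _ _ => by ring
  have hcont : Continuous Q := by fun_prop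
  have hhom : ∀ (c : ℝ) v, Q (c • v) = c ^ 2 * Q v := by
    intro c v
    simp only [hQ, PiLp.smul_apply, smul_eq_mul, Finset.mul_sum]
    exact Finset.sum_congr rfl fun _ _ => by ring
  -- The unit sphere is empty when `p = 0`; otherwise homogeneity of degree two extends its minimum
  -- to all vectors.
  rcases (Metric.sphere (0 : EuclideanSpace ℝ (Fin p)) 1).eq_empty_or_nonempty with he | hne
  · refine ⟨1, one_pos, fun v => ?_⟩
    have : v = 0 := by
      by_contra hv
      have : (‖v‖⁻¹ • v) ∈ Metric.sphere (0 : EuclideanSpace ℝ (Fin p)) 1 := by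
        simp [norm_smul, hv]
      rw [he] at this
      exact this
    simp [this]
  · obtain ⟨u, hu, hmin⟩ := (isCompact_sphere (0 : EuclideanSpace ℝ (Fin p)) 1).exists_isMinOn hne
      hcont.continuousOn
    refine ⟨Q u, hpos u fun h => by simp [h] at hu, fun v => ?_⟩
    by_cases hv : v = 0
    · simp [hv]
    have hv' : 0 < ‖v‖ := norm_pos_iff.2 hv
    have h1 : Q u ≤ Q (‖v‖⁻¹ • v) := hmin (by simp [norm_smul, hv])
    rw [hhom, inv_pow, inv_mul_eq_div, le_div_iff₀ (by positivity)] at h1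
    exact h1

end GLMSubsampling

/-! ### Good data with probability tending to one -/

namespace GLMSubsampling

section Design

variable {p n : ℕ} {F : ExpFamily}

lemma sum_mul_infoMatrix (d : Dataset p n) (β v : EuclideanSpace ℝ (Fin p)) :
    ∑ q : Fin p × Fin p, (v q.1 * v q.2) * infoMatrix F d β q.1 q.2 =
      popMean fun i => deriv (deriv F.ψ) (inner ℝ β (d i).1) *
        (inner ℝ v (d i).1 * inner ℝ v (d i).1) := by
  simp only [inner_mul_inner_eq_sum, Finset.mul_sum]
  have : ∀ (q : Fin p × Fin p) (i : Fin n),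
      deriv (deriv F.ψ) (inner ℝ β (d i).1) * (v q.1 * v q.2 * coordProd d q i) =
      (v q.1 * v q.2) * (deriv (deriv F.ψ) (inner ℝ β (d i).1) * coordProd d q i) :=
    fun q i => by ring
  simp only [this]
  rw [popMean_sum]
  refine Finset.sum_congr rfl fun q _ => ?_
  simp only [infoMatrix, popMean, Matrix.smul_apply, Matrix.sum_apply, smul_eq_mul,
    Matrix.vecMulVec_apply, coordProd]

lemma le_sum_mul_of_abs_sub_le (hp : 0 < p) {I J : Matrix (Fin p) (Fin p) ℝ} {m : ℝ}
    (hm : 0 < m) (v : EuclideanSpace ℝ (Fin p))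
    (hJ : m * ‖v‖ ^ 2 ≤ ∑ q : Fin p × Fin p, (v q.1 * v q.2) * J q.1 q.2)
    (h : ∀ j k, |I j k - J j k| ≤ m / (2 * p ^ 2)) :
    m / 2 * ‖v‖ ^ 2 ≤ ∑ q : Fin p × Fin p, (v q.1 * v q.2) * I q.1 q.2 := by
  have hpR : (0 : ℝ) < p := by exact_mod_cast hp
  have h1 : |∑ q : Fin p × Fin p, (v q.1 * v q.2) * (I q.1 q.2 - J q.1 q.2)| ≤
      (∑ q : Fin p × Fin p, |v q.1 * v q.2|) * (m / (2 * p ^ 2)) := by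
    rw [Finset.sum_mul]
    refine (Finset.abs_sum_le_sum_abs _ _).trans (Finset.sum_le_sum fun q _ => ?_)
    rw [abs_mul]
    exact mul_le_mul_of_nonneg_left (h _ _) (abs_nonneg _)
  have h3 := mul_le_mul_of_nonneg_right (sum_abs_mul_apply_le v)
    (by positivity : 0 ≤ m / (2 * (p : ℝ) ^ 2))
  have h4 : (p : ℝ) ^ 2 * ‖v‖ ^ 2 * (m / (2 * p ^ 2)) = m / 2 * ‖v‖ ^ 2 := by field_simp
  simp only [mul_sub, Finset.sum_sub_distrib] at h1
  have h5 := (abs_le.1 h1).1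
  linarith

end Design

lemma tendsto_measure_exists_of_fintype {Ω ι : Type*} [MeasurableSpace Ω] [Fintype ι]
    {P : Measure Ω} {E : ι → ℕ → Set Ω} (h : ∀ i, Tendsto (fun n => P (E i n)) atTop (𝓝 0)) :
    Tendsto (fun n => P {ω | ∃ i, ω ∈ E i n}) atTop (𝓝 0) := by
  have hs : Tendsto (fun n => ∑ i, P (E i n)) atTop (𝓝 0) := by
    simpa using tendsto_finsetSum Finset.univ fun i _ => h i
  refine tendsto_of_tendsto_of_tendsto_of_le_of_le tendsto_const_nhds hs (fun _ => zero_le)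
    fun n => ?_
  have e : {ω | ∃ i, ω ∈ E i n} = ⋃ i, E i n := by ext; simp
  change P {ω | ∃ i, ω ∈ E i n} ≤ _
  rw [e]
  exact measure_iUnion_fintype_le P _

lemma tendsto_measure_union {Ω : Type*} [MeasurableSpace Ω] {P : Measure Ω} {A B : ℕ → Set Ω}
    (hA : Tendsto (fun n => P (A n)) atTop (𝓝 0)) (hB : Tendsto (fun n => P (B n)) atTop (𝓝 0)) :
    Tendsto (fun n => P (A n ∪ B n)) atTop (𝓝 0) :=
  tendsto_of_tendsto_of_tendsto_of_le_of_le tendsto_const_nhds (by simpa using hA.add hB)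
    (fun _ => zero_le) fun _ => measure_union_le _ _

/-- Under the assumptions of the generalized linear model, the parameter domain is regular and the
data are good with probability tending to one. -/
theorem exists_regularDomain_and_goodData {Ω : Type*} [MeasurableSpace Ω] (P : Measure Ω)
    [IsProbabilityMeasure P] {p : ℕ} (hp : 0 < p) (F : ExpFamily)
    {X : ℕ → Ω → EuclideanSpace ℝ (Fin p)} {Y : ℕ → Ω → ℝ}
    (hX : ∀ i, Measurable (X i)) (hY : ∀ i, Measurable (Y i))
    (hindep : iIndepFun (fun i ω => (X i ω, Y i ω)) P) {β₀ : EuclideanSpace ℝ (Fin p)}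
    (hmodel : ∀ i, ∀ᵐ x ∂(P.map (X i)), condDistrib (Y i) (X i) P x = F.law (inner ℝ β₀ x))
    {L : ℝ} (hL : 0 < L) (H1 : ∀ i, ∀ᵐ ω ∂P, ‖X i ω‖ ≤ L) {B : ℝ}
    (H2 : ∀ β ∈ paramDomain F p L B, ∀ x : EuclideanSpace ℝ (Fin p), (∀ j, |x j| ≤ L) →
      inner ℝ β x ∈ interior F.naturalSpace)
    (H3 : β₀ ∈ paramDomain F p L B) (H3c : IsCompact (paramDomain F p L B))
    {mle : ∀ n, Dataset p n → EuclideanSpace ℝ (Fin p)}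
    (hmle : ∀ n (d : Dataset p n), (∀ i, ‖(d i).1‖ ≤ L) →
      IsMaximizer (paramDomain F p L B) (logLik F d) (mle n d))
    (H4 : ∃ J : Matrix (Fin p) (Fin p) ℝ, J.PosDef ∧ ∀ a b,
      TendstoInMeasure P (fun n ω => infoMatrix F (sample X Y n ω) (mle n (sample X Y n ω)) a b)
        atTop (fun _ => J a b)) :
    ∃ κ K A lam : ℝ, RegularDomain F (paramDomain F p L B) L κ K ∧ 0 ≤ A ∧ 0 < lam ∧
      Tendsto (fun n => P {ω | ¬ GoodData (sample X Y n ω) L A lam}) atTop (𝓝 0) := by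
  obtain ⟨a, b, hab, hmem⟩ := exists_Icc_predictors F hL H2 H3c ⟨β₀, H3⟩
  obtain ⟨K, hK, hbd⟩ := F.exists_deriv_bounds hab
  obtain ⟨J, hJ, hconv⟩ := H4
  obtain ⟨m, hm, hmJ⟩ := exists_pos_mul_norm_sq_le hJ
  have hpR : (0 : ℝ) < p := by exact_mod_cast hp
  -- the information matrix at the maximum likelihood estimator is close to `J`
  set E : ℕ → Set Ω := fun n => {ω | ∃ q : Fin p × Fin p, ω ∈ {ω | m / (2 * p ^ 2) ≤
    dist (infoMatrix F (sample X Y n ω) (mle n (sample X Y n ω)) q.1 q.2) (J q.1 q.2)}} with hE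
  have hEt : Tendsto (fun n => P (E n)) atTop (𝓝 0) :=
    tendsto_measure_exists_of_fintype fun q =>
      tendstoInMeasure_iff_dist.1 (hconv q.1 q.2) _ (by positivity)
  set N : Set Ω := {ω | ¬ ∀ i, ‖X i ω‖ ≤ L} with hN
  have hN0 : P N = 0 := ae_iff.1 (ae_all_iff.2 H1)
  have hquad : ∀ n ω, ω ∉ E n → ∀ v : EuclideanSpace ℝ (Fin p), m / 2 * ‖v‖ ^ 2 ≤
      popMean fun i => deriv (deriv F.ψ)
        (inner ℝ (mle n (sample X Y n ω)) (sample X Y n ω i).1) *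
        (inner ℝ v (sample X Y n ω i).1 * inner ℝ v (sample X Y n ω i).1) := by
    intro n ω hω v
    rw [← sum_mul_infoMatrix]
    refine le_sum_mul_of_abs_sub_le hp hm v (hmJ v) fun j k => ?_
    by_contra hcon
    exact hω ⟨(j, k), (not_le.1 hcon).le⟩
  have hmleS : ∀ n ω, ω ∉ N → ∀ i : Fin n,
      inner ℝ (mle n (sample X Y n ω)) (sample X Y n ω i).1 ∈ Set.Icc a b := by
    intro n ω hω i
    have hω' : ∀ i, ‖X i ω‖ ≤ L := not_not.1 hω
    have hx : ∀ i : Fin n, ‖(sample X Y n ω i).1‖ ≤ L := fun i => hω' (i : ℕ)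
    exact hmem (mle n (sample X Y n ω)) (hmle n (sample X Y n ω) hx).1 (sample X Y n ω i).1 (hx i)
  -- In a degenerate family the information form would vanish, contradicting its coercive lower
  -- bound at some sample point outside `E n` and `N`.
  have hne : ∃ θ ∈ interior F.naturalSpace, deriv (deriv F.ψ) θ ≠ 0 := by
    by_contra! hcon
    obtain ⟨n, hn⟩ := (hEt.eventually_lt_const one_pos).exists
    have hlt : P (E n ∪ N) < 1 := (measure_union_le _ _).trans_lt (by rwa [hN0, add_zero])
    obtain ⟨ω, hω⟩ : ∃ ω, ω ∉ E n ∪ N := by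
      by_contra! hall
      rw [Set.eq_univ_of_forall hall, measure_univ] at hlt
      exact lt_irrefl _ hlt
    have h := hquad n ω (fun h => hω (Or.inl h)) (EuclideanSpace.single ⟨0, hp⟩ 1)
    have hz : ∀ i : Fin n, deriv (deriv F.ψ)
        (inner ℝ (mle n (sample X Y n ω)) (sample X Y n ω i).1) = 0 := fun i =>
      hcon _ (hab (hmleS n ω (fun h => hω (Or.inr h)) i))
    simp only [hz, zero_mul] at h
    simp [popMean] at h
    linarith
  obtain ⟨κ, hκ, hκle⟩ := F.exists_pos_le_deriv_deriv hab hne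
  obtain ⟨M, hM, hmom⟩ := F.exists_lintegral_pow_four_le hab
  refine ⟨κ, K, 2 + M, m / (2 * K), ⟨hL, hκ, hK, convex_paramDomain F p L B,
    fun β hβ x hx => (F.analyticOnNhd_ψ _ (hab (hmem β hβ x hx))).differentiableAt,
    fun β hβ γ hγ x hx => ?_, fun β hβ x hx => (hbd _ (hmem β hβ x hx)).2.1,
    fun β hβ x hx => hκle _ (hmem β hβ x hx), fun β hβ x hx => (hbd _ (hmem β hβ x hx)).2.2⟩,
    by positivity, by positivity, ?_⟩
  · rw [inner_sub_left]
    exact F.ψ_tangent_le hab hκle (hmem β hβ x hx) (hmem γ hγ x hx)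
  -- The weak law is applied to the squared responses, whence the need for fourth moments.
  have hsq : Tendsto (fun n : ℕ => P {ω | ¬ (n : ℝ)⁻¹ * ∑ i ∈ Finset.range n, Y i ω ^ 2 ≤ 2 + M})
      atTop (𝓝 0) := by
    refine tendsto_measure_average_gt (Z := fun i ω => Y i ω ^ 2) (fun i => (hY i).pow_const 2)
      (hindep.comp (fun _ z => z.2 ^ 2) fun _ => by fun_prop) hM fun i => ?_
    have e : ∀ ω, (Y i ω ^ 2) ^ 2 = Y i ω ^ 4 := fun ω => by ring
    simp only [e]
    refine lintegral_le_of_condDistrib (P := P) (hX i) (hY i) (g := fun y => ENNReal.ofReal (y ^ 4))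
      (by fun_prop) ?_
    have hx : ∀ᵐ x ∂(P.map (X i)), ‖x‖ ≤ L :=
      (ae_map_iff (hX i).aemeasurable (measurableSet_le measurable_norm measurable_const)).2 (H1 i)
    filter_upwards [hmodel i, hx] with x h1 h2
    rw [h1]
    exact hmom _ (hmem β₀ H3 x h2)
  have hNt : Tendsto (fun _ : ℕ => P N) atTop (𝓝 0) := by rw [hN0]; exact tendsto_const_nhds
  refine tendsto_of_tendsto_of_tendsto_of_le_of_le tendsto_const_nhds
    (tendsto_measure_union hNt (tendsto_measure_union hEt hsq)) (fun _ => zero_le)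
    fun n => measure_mono fun ω hω => ?_
  by_contra hcon
  simp only [Set.mem_union, not_or] at hcon
  obtain ⟨h1, h2, h3⟩ := hcon
  have hω' : ∀ i, ‖X i ω‖ ≤ L := not_not.1 h1
  refine hω ⟨fun i => hω' i, ?_, fun v => ?_⟩
  · have h3' : (n : ℝ)⁻¹ * ∑ i ∈ Finset.range n, Y i ω ^ 2 ≤ 2 + M := not_not.1 h3
    rw [Finset.sum_range] at h3'
    exact h3'
  · have h4 := hquad n ω h2 v
    have h5 : popMean (fun i => deriv (deriv F.ψ)
        (inner ℝ (mle n (sample X Y n ω)) (sample X Y n ω i).1) *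
        (inner ℝ v (sample X Y n ω i).1 * inner ℝ v (sample X Y n ω i).1)) ≤
        popMean fun i => K * (inner ℝ v (sample X Y n ω i).1 * inner ℝ v (sample X Y n ω i).1) :=
      popMean_mono fun i => mul_le_mul_of_nonneg_right (hbd _ (hmleS n ω h1 i)).2.2
        (mul_self_nonneg _)
    rw [popMean_const_mul] at h5
    -- Dividing by the upper bound `K` for `ψ''` passes from the information form to the unweighted
    -- design.
    have e : m / (2 * K) * ‖v‖ ^ 2 = (m / 2 * ‖v‖ ^ 2) / K := by field_simp
    rw [e, div_le_iff₀ hK]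
    linarith

end GLMSubsampling

/-! ### Passage to the two limits -/

theorem theorem7
    {Ω : Type*} [MeasurableSpace Ω] (P : Measure Ω) [IsProbabilityMeasure P]
    (p : ℕ) (hp : 0 < p) (F : ExpFamily)
    -- independent observations from the generalized linear model with true parameter `β₀`
    (X : ℕ → Ω → EuclideanSpace ℝ (Fin p)) (Y : ℕ → Ω → ℝ)
    (hX : ∀ i, Measurable (X i)) (hY : ∀ i, Measurable (Y i))
    (hindep : iIndepFun (fun i ω => (X i ω, Y i ω)) P)
    (β₀ : EuclideanSpace ℝ (Fin p))
    (hmodel : ∀ i, ∀ᵐ x ∂(P.map (X i)), condDistrib (Y i) (X i) P x = F.law (inner ℝ β₀ x))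
    -- (H.1)
    (L : ℝ) (hL : 0 < L) (H1 : ∀ i, ∀ᵐ ω ∂P, ‖X i ω‖ ≤ L)
    -- (H.2) and (H.3)
    (B : ℝ)
    (H2 : ∀ β ∈ paramDomain F p L B, ∀ x : EuclideanSpace ℝ (Fin p), (∀ j, |x j| ≤ L) →
      inner ℝ β x ∈ interior F.naturalSpace)
    (H3 : β₀ ∈ paramDomain F p L B) (H3c : IsCompact (paramDomain F p L B))
    -- the full data maximum likelihood estimator
    (mle : ∀ n, Dataset p n → EuclideanSpace ℝ (Fin p))
    (hmle : ∀ n (d : Dataset p n), (∀ i, ‖(d i).1‖ ≤ L) →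
      IsMaximizer (paramDomain F p L B) (logLik F d) (mle n d))
    -- (H.4)
    (H4 : ∃ J : Matrix (Fin p) (Fin p) ℝ, J.PosDef ∧ ∀ a b,
      TendstoInMeasure P (fun n ω => infoMatrix F (sample X Y n ω) (mle n (sample X Y n ω)) a b)
        atTop (fun _ => J a b))
    -- the pilot sampling distribution, with `max_i 1 / (n π₀ᵢ) = O_P(1)`
    (π₀ : ∀ n, Dataset p n → Fin n → ℝ)
    (hπ₀ : ∀ n, 0 < n → ∀ d : Dataset p n, (∀ i, 0 ≤ π₀ n d i) ∧ ∑ i, π₀ n d i = 1)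
    (H5 : ∀ η : ℝ, 0 < η → ∃ C : ℝ, 0 < C ∧ ∀ᶠ n : ℕ in atTop,
      P {ω | ∃ i, C * (n * π₀ n (sample X Y n ω) i) < 1} ≤ ENNReal.ofReal η)
    -- the two-step algorithm
    (c : Criterion) (δ : ℝ) (hδ : 0 < δ)
    (pilot : ∀ n r₀ : ℕ, Dataset p n → (Fin r₀ → Fin n) → EuclideanSpace ℝ (Fin p))
    (hpilot : ∀ (n r₀ : ℕ) (d : Dataset p n) (s : Fin r₀ → Fin n), (∀ i, ‖(d i).1‖ ≤ L) →
      IsMaximizer (paramDomain F p L B) (pilotLogLik F (π₀ n d) d s) (pilot n r₀ d s))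
    (est : ∀ n r₀ r : ℕ, Dataset p n → (Fin r₀ → Fin n) → (Fin r → Fin n) →
      EuclideanSpace ℝ (Fin p))
    (hest : ∀ (n r₀ r : ℕ) (d : Dataset p n) (s : Fin r₀ → Fin n) (t : Fin r → Fin n),
      (∀ i, ‖(d i).1‖ ≤ L) →
      IsMaximizer (paramDomain F p L B)
        (twoStepLogLik F (π₀ n d) (stepTwoProb F c δ (π₀ n d) d s (pilot n r₀ d s)) d s t)
        (est n r₀ r d s t))
    -- the pilot size `r₀ = m n r`: `r₀ → ∞` and `r₀ / r → 0` as `n → ∞` and `r → ∞`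
    (m : ℕ → ℕ → ℕ)
    (hm : Tendsto (fun q : ℕ × ℕ => m q.1 q.2) atTop atTop)
    (hmr : Tendsto (fun q : ℕ × ℕ => (m q.1 q.2 : ℝ) / q.2) atTop (𝓝 0)) :
    -- the failure event tends to probability zero as `n → ∞` and `R → ∞`
    (∀ ε : ℝ, 0 < ε → ∃ Δ : ℝ, 0 < Δ ∧
      Tendsto (fun q : ℕ × ℕ => P {ω | ¬ ∀ r : ℕ, q.2 < r →
        errorProb F c δ (π₀ q.1 (sample X Y q.1 ω)) (sample X Y q.1 ω) (m q.1 r) r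
          (pilot q.1 (m q.1 r) (sample X Y q.1 ω)) (est q.1 (m q.1 r) r (sample X Y q.1 ω))
          (mle q.1 (sample X Y q.1 ω)) ((r : ℝ) ^ (-(1 / 2) : ℝ) * Δ) < ENNReal.ofReal ε})
        atTop (𝓝 0)) ∧
    -- if `max_i 1 / (n π₀ᵢ)` is bounded by a constant with probability tending to one
    -- (for instance, if `π₀` is uniform), then `R` can be fixed
    ((∃ C : ℝ, 0 < C ∧ Tendsto (fun n : ℕ =>
        P {ω | ∃ i, C * (n * π₀ n (sample X Y n ω) i) < 1}) atTop (𝓝 0)) →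
      ∀ ε : ℝ, 0 < ε → ∃ Δ : ℝ, 0 < Δ ∧ ∃ R : ℕ,
        Tendsto (fun n : ℕ => P {ω | ¬ ∀ r : ℕ, R < r →
          errorProb F c δ (π₀ n (sample X Y n ω)) (sample X Y n ω) (m n r) r
            (pilot n (m n r) (sample X Y n ω)) (est n (m n r) r (sample X Y n ω))
            (mle n (sample X Y n ω)) ((r : ℝ) ^ (-(1 / 2) : ℝ) * Δ) < ENNReal.ofReal ε})
          atTop (𝓝 0)) := by
  obtain ⟨κ, K, A, lam, hF, hA, hlam, hgood⟩ :=
    exists_regularDomain_and_goodData P hp F hX hY hindep hmodel hL H1 H2 H3 H3c hmle H4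
  -- The joint limits of `m` hold on a quadrant, so one `N` serves both `n` and `r`; it depends on
  -- `C`, whereas `Δ` does not.
  have key : ∀ ε : ℝ, 0 < ε → ∃ Δ : ℝ, 0 < Δ ∧ ∀ C : ℝ, 0 < C → ∃ N : ℕ, ∀ n, N ≤ n → ∀ ω,
      GoodData (sample X Y n ω) L A lam → (¬ ∃ i, C * (n * π₀ n (sample X Y n ω) i) < 1) →
      ∀ r, N < r →
        errorProb F c δ (π₀ n (sample X Y n ω)) (sample X Y n ω) (m n r) r
          (pilot n (m n r) (sample X Y n ω)) (est n (m n r) r (sample X Y n ω))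
          (mle n (sample X Y n ω)) ((r : ℝ) ^ (-(1 / 2) : ℝ) * Δ) < ENNReal.ofReal ε := by
    intro ε hε
    obtain ⟨Δ, hΔ, hcore⟩ := exists_errorProb_lt hp hF hlam hA hδ c hε
    refine ⟨Δ, hΔ, fun C hC => ?_⟩
    obtain ⟨M, η, hη, hlt⟩ := hcore C hC
    obtain ⟨⟨N₁, N₂⟩, hN⟩ := eventually_atTop.1
      ((hm.eventually_ge_atTop M).and (hmr.eventually_le_const hη))
    refine ⟨max (max N₁ N₂) (max M 1), fun n hn ω hd hC' r hr => ?_⟩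
    simp only [max_le_iff] at hn
    simp only [max_lt_iff] at hr
    obtain ⟨hq1, hq2⟩ := hN (n, r) ⟨hn.1.1, hr.1.2.le⟩
    have hn0 : 0 < n := hn.2.2
    obtain ⟨h0, h1⟩ := hπ₀ n hn0 (sample X Y n ω)
    push Not at hC'
    exact hlt n hn0 _ hd _ h0 h1 hC' (m n r) r hq1 hr.2.1.le hq2 _
      (fun s => (hpilot n _ _ s hd.norm_le).1) _ (fun s t => hest n _ r _ s t hd.norm_le) _
      (hmle n _ hd.norm_le)
  refine ⟨fun ε hε => ?_, ?_⟩
  · obtain ⟨Δ, hΔ, hC⟩ := key ε hε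
    refine ⟨Δ, hΔ, ?_⟩
    rw [ENNReal.tendsto_nhds_zero]
    intro x hx
    obtain ⟨η, hη, hηx⟩ : ∃ η : ℝ, 0 < η ∧ ENNReal.ofReal η + ENNReal.ofReal η ≤ x := by
      obtain ⟨y, hy0, hyx⟩ := ENNReal.lt_iff_exists_real_btwn.1 hx
      have hy : 0 < y := ENNReal.ofReal_pos.1 hyx.1
      refine ⟨y / 2, by positivity, ?_⟩
      rw [← ENNReal.ofReal_add (by positivity) (by positivity), add_halves]
      exact hyx.2.le
    -- Under `O_P(1)` the constant, and with it `N`, depends on the probability tolerance; hence `R`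
    -- must grow.
    obtain ⟨C, hC0, hCη⟩ := H5 η hη
    obtain ⟨N, hN⟩ := hC C hC0
    have hg := ENNReal.tendsto_nhds_zero.1 hgood (ENNReal.ofReal η) (ENNReal.ofReal_pos.2 hη)
    obtain ⟨N', hN'⟩ := eventually_atTop.1 (hCη.and hg)
    filter_upwards [eventually_ge_atTop (max N N', N)] with q hq
    have hq1 : max N N' ≤ q.1 := hq.1
    have hq2 : N ≤ q.2 := hq.2
    obtain ⟨hb1, hb2⟩ := hN' q.1 ((le_max_right _ _).trans hq1)
    refine le_trans (measure_mono fun ω hω => ?_) ((measure_union_le _ _).trans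
      ((add_le_add hb1 hb2).trans hηx))
    by_contra hcon
    simp only [Set.mem_union, not_or] at hcon
    exact hω fun r hr => hN q.1 ((le_max_left _ _).trans hq1) ω (not_not.1 hcon.2) hcon.1 r
      (hq2.trans_lt hr)
  · rintro ⟨C, hC0, hCt⟩ ε hε
    obtain ⟨Δ, hΔ, hC⟩ := key ε hε
    obtain ⟨N, hN⟩ := hC C hC0
    -- Here `C` is fixed in advance, so `N` itself can serve as the fixed threshold for `r`.
    refine ⟨Δ, hΔ, N, ?_⟩
    refine tendsto_of_tendsto_of_tendsto_of_le_of_le' tendsto_const_nhds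
      (tendsto_measure_union hCt hgood) (.of_forall fun _ => zero_le) ?_
    filter_upwards [eventually_ge_atTop N] with n hn
    refine measure_mono fun ω hω => ?_
    by_contra hcon
    simp only [Set.mem_union, not_or] at hcon
    exact hω fun r hr => hN n hn ω (not_not.1 hcon.2) hcon.1 r hr
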